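/- **Setting.** The inputs are simple graphs $G$ on the vertex set $[n]$ with integer edge weights in $\{1,\dots,w\}$, where $w\ge 1$ and $w<n/2$. A randomized algorithm accesses $G$ by adjacency-list queries: a degree query $v\mapsto\deg(v)$, or a neighbor query $(v,i)\mapsto$ the $i$-th neighbor of $v$ together with the weight of the connecting edge, or $\perp$ if $i>\deg(v)$. The order of the lists is arbitrary. Two weighted graphs are edge-neighboring if there is one vertex pair $e$ such that, apart from $e$, they have the same edges with the same weights. The algorithm $\mathcal A'$ is $\varepsilon$-edge differentially private if $\Pr[\mathcal A'(G)\in S]\le e^{\varepsilon}\Pr[\mathcal A'(H)\in S]$ for all edge-neighboring $G,H$ (connected or not), all adjacency-list representations of them, and all measurable $S\subseteq\mathbb R$. For connected $G$ let $\mathsf M(G)$ be the weight of a minimum spanning tree of $G$, and let $\bar d=\bar d(G)=2|E(G)|/n$ be its average degree. Logarithms are natural. **Corollary.** For all $c>0$ and $\varepsilon_0>0$ there are constants $C',C>0$ and $N\in\mathbb N$ such that for all integers $K>0$, all $0<\varepsilon\le\varepsilon_0$, all $0<\alpha<1$ and all integers $n,w$ with $1\le w<n/2$ there is a randomized algorithm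 $\mathcal A'$ in the above query model such that: 1. (Privacy) $\mathcal A'$ is $\varepsilon$-edge differentially private. 2. (Accuracy) For every connected weighted graph $G$ on $n$ vertices with weights in $\{1,\dots,w\}$ (in any adjacency-list representation), with probability at least $1-\frac1{n^{c}}-\frac{1}{n^{c-3}(e^{\varepsilon}-1)/K+1}$, $$(1-\alpha')\,\mathsf M(G)-\frac{2cw\log n}{\varepsilon}-\frac1{Kn^3}\;\le\;\mathcal A'(G)\;\le\;(1+\alpha')\,\mathsf M(G)+\frac{2cw\log n}{\varepsilon}+\frac1{Kn^3},$$ where $\alpha'=\alpha\left(1+\frac{\varepsilon}{C'\log n}\right)$. 3. (Queries) If $n\ge N$, then for every such connected $G$, with probability at least $1-\frac1{n^c}$, $\mathcal A'$ makes at most $$C\cdot\bar d\,w\,\frac{\log^3 n}{\alpha^2\varepsilon^2}\,\log\!\left(\frac{\bar d\,w\log n}{\alpha\varepsilon}\right)$$ queries. -/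

import Mathlib

open MeasureTheory

/-- A simple graph on `n` vertices with integer edge weights in `{1, …, w}`
(the values of `weight` outside the edge set are irrelevant). -/
structure WeightedGraph (n w : ℕ) where
  graph : SimpleGraph (Fin n)
  weight : Sym2 (Fin n) → ℕ
  weight_mem : ∀ e ∈ graph.edgeSet, 1 ≤ weight e ∧ weight e ≤ w

namespace WeightedGraph

variable {n w : ℕ}

/-- The average degree `2m / n`. -/
noncomputable def avgDegree (G : WeightedGraph n w) : ℝ :=
  2 * (G.graph.edgeSet.ncard : ℝ) / (n : ℝ)

/-- The total weight of a set of edges. -/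
noncomputable def edgeWeight (G : WeightedGraph n w) (E : Set (Sym2 (Fin n))) : ℕ :=
  ∑ e ∈ E.toFinite.toFinset, G.weight e

/-- The weight of a minimum spanning tree (meaningful for connected graphs). -/
noncomputable def mstWeight (G : WeightedGraph n w) : ℕ :=
  sInf {m : ℕ | ∃ T : SimpleGraph (Fin n), T ≤ G.graph ∧ T.IsTree ∧ m = G.edgeWeight T.edgeSet}

/-- Two weighted graphs are edge-neighboring if, outside a single vertex pair `e`, they have
the same edges with the same weights; so `e` may be added, deleted or given a new weight. -/
def EdgeNeighboring (G H : WeightedGraph n w) : Prop :=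
  ∃ e : Sym2 (Fin n), ∀ e' : Sym2 (Fin n), e' ≠ e →
    ((e' ∈ G.graph.edgeSet ↔ e' ∈ H.graph.edgeSet) ∧
      (e' ∈ G.graph.edgeSet → G.weight e' = H.weight e'))

/-- An adjacency list representation: every vertex lists its neighbors, in some order. -/
structure AdjList (G : WeightedGraph n w) where
  nbrs : Fin n → List (Fin n)
  nodup : ∀ v, (nbrs v).Nodup
  mem_nbrs : ∀ v u, u ∈ nbrs v ↔ G.graph.Adj v u

/-- Answer to a degree query. -/
def AdjList.degree {G : WeightedGraph n w} (L : G.AdjList) (v : Fin n) : ℕ :=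
  (L.nbrs v).length

/-- Answer to a neighbor query: the neighbor of `v` at position `i` of its list (counted from
`0`) together with the weight of the connecting edge, or `none` if the list is too short. -/
def AdjList.neighbor {G : WeightedGraph n w} (L : G.AdjList) (v i : Fin n) :
    Option (Fin n × ℕ) :=
  ((L.nbrs v)[(i : ℕ)]?).map fun u => (u, G.weight s(v, u))

end WeightedGraph

/-- A deterministic adaptive algorithm in the adjacency list query model on `n` vertices, as a
decision tree: it outputs a real number, or asks a degree or a neighbor query and continues
depending on the answer. -/
inductive QueryTree (n : ℕ) : Type where
  | output (x : ℝ) : QueryTree n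
  | degreeQuery (v : Fin n) (next : ℕ → QueryTree n) : QueryTree n
  | neighborQuery (v i : Fin n) (next : Option (Fin n × ℕ) → QueryTree n) : QueryTree n

namespace QueryTree

variable {n w : ℕ} {G : WeightedGraph n w}

/-- The output on a given input. -/
def eval (L : G.AdjList) : QueryTree n → ℝ
  | output x => x
  | degreeQuery v next => eval L (next (L.degree v))
  | neighborQuery v i next => eval L (next (L.neighbor v i))

/-- The number of queries made on a given input. -/
def queries (L : G.AdjList) : QueryTree n → ℕ
  | output _ => 0
  | degreeQuery v next => queries L (next (L.degree v)) + 1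
  | neighborQuery v i next => queries L (next (L.neighbor v i)) + 1

end QueryTree

/-- A randomized query algorithm for `n`-vertex graphs with weights in `{1, …, w}`: random coins
drawn from a probability space, and a deterministic query algorithm for every outcome of the
coins. -/
structure QueryAlgorithm (n w : ℕ) where
  Coins : Type
  mCoins : MeasurableSpace Coins
  law : Measure Coins
  isProb : IsProbabilityMeasure law
  tree : Coins → QueryTree n
  measurable_eval : ∀ (G : WeightedGraph n w) (L : G.AdjList),
    Measurable fun r => (tree r).eval L
  measurable_queries : ∀ (G : WeightedGraph n w) (L : G.AdjList),
    Measurable fun r => (tree r).queries L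

namespace QueryAlgorithm

variable {n w : ℕ}

/-- The probability that the output on the given input lies in `S`. -/
noncomputable def probOutput (A : QueryAlgorithm n w) {G : WeightedGraph n w} (L : G.AdjList)
    (S : Set ℝ) : ℝ :=
  (@Measure.real A.Coins A.mCoins A.law {r | (A.tree r).eval L ∈ S})

/-- The probability that at most `B` queries are made on the given input. -/
noncomputable def probQueriesLE (A : QueryAlgorithm n w) {G : WeightedGraph n w} (L : G.AdjList)
    (B : ℝ) : ℝ :=
  (@Measure.real A.Coins A.mCoins A.law {r | ((A.tree r).queries L : ℝ) ≤ B})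

/-- `ε`-edge differential privacy, over all edge-neighboring weighted graphs (connected or not)
and all adjacency list representations of them. -/
def IsEdgeDP (A : QueryAlgorithm n w) (ε : ℝ) : Prop :=
  ∀ (G H : WeightedGraph n w), G.EdgeNeighboring H →
    ∀ (L : G.AdjList) (L' : H.AdjList) (S : Set ℝ), MeasurableSet S →
      A.probOutput L S ≤ Real.exp ε * A.probOutput L' S

end QueryAlgorithm

/-! Let `c_i` be the number of components of the graph of edges of weight at most `i`, and `F = ∑_{i
< w} c_i`. Kruskal's algorithm gives `M(G) + w = F` for connected `G` (`mstWeight_add`). The sum `F`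
makes sense for every graph, and changing one vertex pair changes each `c_i` by at most one, so `F`
has sensitivity `w` (`EdgeNeighboring.componentSum_le`). It remains to estimate `F` with few queries
and to publish the estimate privately.

Estimation: call the sum of `deg + 1` over a component its volume. Summing `(deg u + 1) / vol(u)`
over all vertices `u` counts components. A sample at threshold `i` is a uniform vertex `u` and a
uniform `a < Q`; it is a hit if the component of `u` has volume at most `Q (deg u + 1) / (a + 1)`,
which has probability `(deg u + 1) / vol(u)` up to `1 / Q`. Exploration stops at this budget, whose
mean is at most `(d̄ + 1)(1 + log Q)`. Discarding the `k` largest budgets makes the cost bound hold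
with high probability and hardly moves the count. With `r` samples per threshold a Chernoff bound
gives relative error `β / 4`, except with small probability `δ` (`card_bad_estimate_le`,
`card_expensive_le`).

Privacy: the estimates on two neighboring inputs, with the same coins, differ by about `w + β F`.
The map `x ↦ log (1 + β x / w) / β` turns this into a difference of at most one
(`logScale_le_add_one`), so geometric noise of scale `1 / ε`, on a grid of mesh `1 / m`, hides it.
The noise is `O(log n / ε)`; mapped back it costs `O(w log n / ε)` plus a relative error of order `β
log n / ε`, which forces `β` of order `α ε / log n` and hence `r` of order `log³ n / (α ε)²`.

The coins on which an estimate fails would only give approximate privacy. Mixing the noise with the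
uniform distribution on the grid, with weight `p`, gives each output probability at least `p / (m n
+ 1)`, and this absorbs `δ` into the factor `e^ε` (`sum_mixKernel_le_mul`, `mix_condition`). The
weight `p` is the second failure term of the accuracy claim. -/

/-! ### Forests and numbers of components -/

namespace SimpleGraph

variable {V : Type*}

/-- A walk in `G` plus the edge `uv` either avoids that edge or passes through it. -/
theorem Reachable.of_sup_edge {G : SimpleGraph V} {u v x y : V}
    (h : (G ⊔ edge u v).Reachable x y) :
    G.Reachable x y ∨ (G.Reachable x u ∧ G.Reachable v y) ∨
      (G.Reachable x v ∧ G.Reachable u y) := by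
  obtain ⟨p⟩ := h
  induction p with
  | nil => exact Or.inl (Reachable.refl _)
  | cons hadj _ ih =>
    rw [sup_adj, edge_adj] at hadj
    rcases hadj with hadj | ⟨⟨rfl, rfl⟩ | ⟨rfl, rfl⟩, _⟩
    · have := hadj.reachable
      rcases ih with h | ⟨h1, h2⟩ | ⟨h1, h2⟩
      · exact Or.inl (this.trans h)
      · exact Or.inr (Or.inl ⟨this.trans h1, h2⟩)
      · exact Or.inr (Or.inr ⟨this.trans h1, h2⟩)
    · rcases ih with h | ⟨h1, h2⟩ | ⟨h1, h2⟩
      · exact Or.inr (Or.inl ⟨.refl _, h⟩)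
      · exact Or.inr (Or.inl ⟨.refl _, h2⟩)
      · exact Or.inl h2
    · rcases ih with h | ⟨h1, h2⟩ | ⟨h1, h2⟩
      · exact Or.inr (Or.inr ⟨.refl _, h⟩)
      · exact Or.inl h2
      · exact Or.inr (Or.inr ⟨.refl _, h2⟩)

/-- Joining two components by an edge decreases the number of components by one. -/
theorem card_connectedComponent_sup_edge [Finite V] {G : SimpleGraph V} {u v : V}
    (h : ¬ G.Reachable u v) :
    Nat.card (G ⊔ edge u v).ConnectedComponent + 1 = Nat.card G.ConnectedComponent := by
  classical
  have huv : u ≠ v := fun h' => h (h' ▸ Reachable.refl _)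
  have hadj : (G ⊔ edge u v).Adj u v := by simp [edge_adj, huv]
  -- With the component of `v` left out, the merged component has exactly one preimage, the
  -- component of `u`.
  let f : {c : G.ConnectedComponent // c ≠ G.connectedComponentMk v} →
      (G ⊔ edge u v).ConnectedComponent := fun c => c.1.map (Hom.ofLE le_sup_left)
  have hf : Function.Bijective f := by
    constructor
    · rintro ⟨c, hc⟩ ⟨c', hc'⟩ hcc
      induction c using ConnectedComponent.ind with | _ x
      induction c' using ConnectedComponent.ind with | _ y
      have hxy : (G ⊔ edge u v).Reachable x y := ConnectedComponent.exact hcc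
      rw [Subtype.mk.injEq]
      rcases hxy.of_sup_edge with h1 | ⟨_, h2⟩ | ⟨h1, _⟩
      · exact ConnectedComponent.sound h1
      · exact absurd (ConnectedComponent.sound h2.symm) hc'
      · exact absurd (ConnectedComponent.sound h1) hc
    · intro c
      induction c using ConnectedComponent.ind with | _ x
      by_cases hx : G.connectedComponentMk x = G.connectedComponentMk v
      · refine ⟨⟨G.connectedComponentMk u, fun h' => h (ConnectedComponent.exact h')⟩, ?_⟩
        refine ConnectedComponent.sound ?_
        exact hadj.reachable.trans ((ConnectedComponent.exact hx).symm.mono le_sup_left)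
      · exact ⟨⟨_, hx⟩, rfl⟩
  rw [← Nat.card_eq_of_bijective f hf]
  have := Fintype.ofFinite G.ConnectedComponent
  have hcard := Fintype.card_subtype_compl (fun c : G.ConnectedComponent =>
    c = G.connectedComponentMk v)
  have hpos : 0 < Fintype.card G.ConnectedComponent := Fintype.card_pos_iff.2
    ⟨G.connectedComponentMk v⟩
  simp only [Fintype.card_subtype_eq] at hcard
  rw [Nat.card_eq_fintype_card, Nat.card_eq_fintype_card]
  simp only [ne_eq]
  omega

/-- The number of edges of a forest plus its number of components is the number of vertices. -/
theorem IsAcyclic.ncard_edgeSet_add_card_connectedComponent [Finite V] {G : SimpleGraph V}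
    (hG : G.IsAcyclic) :
    G.edgeSet.ncard + Nat.card G.ConnectedComponent = Nat.card V := by
  induction hk : G.edgeSet.ncard generalizing G with
  | zero =>
    have hbot : G = ⊥ := by
      rwa [Set.ncard_eq_zero (Set.toFinite _), edgeSet_eq_empty] at hk
    subst hbot
    rw [zero_add]
    refine (Nat.card_eq_of_bijective (fun x : V => (⊥ : SimpleGraph V).connectedComponentMk x)
      ⟨fun x y hxy => ?_, fun c => ?_⟩).symm
    · simpa using ConnectedComponent.exact hxy
    · induction c using ConnectedComponent.ind with | _ x
      exact ⟨x, rfl⟩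
  | succ k ih =>
    obtain ⟨e, he⟩ : G.edgeSet.Nonempty := by
      rw [← Set.ncard_pos (Set.toFinite _)]; omega
    induction e using Sym2.ind with | _ u v
    have hbridge := isAcyclic_iff_forall_isBridge.1 hG he
    rw [isBridge_iff] at hbridge
    have hsup : G.deleteEdges {s(u, v)} ⊔ edge u v = G := by
      ext x y
      have hne : G.Adj u v := he
      simp only [sup_adj, deleteEdges_adj, edge_adj, Set.mem_singleton_iff, Sym2.eq_iff]
      constructor
      · rintro (h | ⟨⟨rfl, rfl⟩ | ⟨rfl, rfl⟩, _⟩)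
        · exact h.1
        · exact hne
        · exact hne.symm
      · intro h
        have := h.ne
        tauto
    have hcard := card_connectedComponent_sup_edge hbridge
    rw [hsup] at hcard
    have hdel : (G.deleteEdges {s(u, v)}).edgeSet.ncard = k := by
      rw [edgeSet_deleteEdges, Set.ncard_sdiff_singleton_of_mem he]
      omega
    have := ih (hG.anti (deleteEdges_le _)) hdel
    omega

theorem IsAcyclic.ncard_edgeSet_add_card_connectedComponent_le [Finite V] {F G : SimpleGraph V}
    (hF : F.IsAcyclic) (hle : F ≤ G) :
    F.edgeSet.ncard + Nat.card G.ConnectedComponent ≤ Nat.card V := by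
  have := hF.ncard_edgeSet_add_card_connectedComponent
  have := ConnectedComponent.card_le_card_of_le hle
  omega

theorem card_connectedComponent_congr {F G : SimpleGraph V}
    (h : F.Reachable = G.Reachable) :
    Nat.card F.ConnectedComponent = Nat.card G.ConnectedComponent := by
  exact Nat.card_congr (Quot.congrRight fun a b => by rw [h])

/-- Changing a single pair changes the number of components by at most one. -/
theorem card_connectedComponent_le_succ [Finite V] {G H : SimpleGraph V} {e : Sym2 V}
    (h : ∀ e' ≠ e, e' ∈ H.edgeSet → e' ∈ G.edgeSet) :
    Nat.card G.ConnectedComponent ≤ Nat.card H.ConnectedComponent + 1 := by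
  -- A spanning forest of `H` without `e` is a forest in `G` that has lost at most one edge.
  obtain ⟨F, hFH, hF, hreach⟩ := H.exists_isAcyclic_reachable_eq_le
  have h1 := hF.ncard_edgeSet_add_card_connectedComponent
  rw [card_connectedComponent_congr hreach] at h1
  have hle : F.deleteEdges {e} ≤ G := by
    rw [← edgeSet_subset_edgeSet, edgeSet_deleteEdges]
    rintro e' ⟨he', hne⟩
    exact h e' hne (edgeSet_subset_edgeSet.2 hFH he')
  have h2 := (hF.anti (deleteEdges_le {e})).ncard_edgeSet_add_card_connectedComponent_le hle
  rw [edgeSet_deleteEdges] at h2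
  have h3 := Set.pred_ncard_le_ncard_sdiff_singleton F.edgeSet e
  omega

end SimpleGraph

/-! ### Threshold graphs and the weight of a minimum spanning tree -/

namespace WeightedGraph

variable {n w : ℕ}

/-- The graph of the edges of weight at most `i`. -/
def threshold (G : WeightedGraph n w) (i : ℕ) : SimpleGraph (Fin n) where
  Adj u v := G.graph.Adj u v ∧ G.weight s(u, v) ≤ i
  symm := ⟨fun u v h => ⟨h.1.symm, by rw [Sym2.eq_swap]; exact h.2⟩⟩
  loopless := ⟨fun u h => G.graph.loopless.irrefl u h.1⟩

theorem mem_edgeSet_threshold (G : WeightedGraph n w) (i : ℕ) (e : Sym2 (Fin n)) :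
    e ∈ (G.threshold i).edgeSet ↔ e ∈ G.graph.edgeSet ∧ G.weight e ≤ i := by
  induction e using Sym2.ind with | _ u v
  rfl

theorem threshold_mono (G : WeightedGraph n w) {i j : ℕ} (h : i ≤ j) :
    G.threshold i ≤ G.threshold j := fun _ _ huv => ⟨huv.1, huv.2.trans h⟩

theorem threshold_le (G : WeightedGraph n w) (i : ℕ) : G.threshold i ≤ G.graph :=
  fun _ _ huv => huv.1

theorem threshold_eq_graph (G : WeightedGraph n w) : G.threshold w = G.graph :=
  le_antisymm (G.threshold_le w) fun _ _ huv => ⟨huv, (G.weight_mem _ huv).2⟩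

/-- The number of connected components of the graph of the edges of weight at most `i`. -/
noncomputable def numComponents (G : WeightedGraph n w) (i : ℕ) : ℕ :=
  Nat.card (G.threshold i).ConnectedComponent

/-- The sum of the numbers of components over all thresholds `0, …, w - 1`. -/
noncomputable def componentSum (G : WeightedGraph n w) : ℕ :=
  ∑ i ∈ Finset.range w, G.numComponents i

theorem numComponents_zero (G : WeightedGraph n w) : G.numComponents 0 = n := by
  have hbot : G.threshold 0 = ⊥ := by
    ext u v
    simp only [threshold, SimpleGraph.bot_adj, iff_false, not_and]
    intro h h'
    have := (G.weight_mem s(u, v) h).1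
    omega
  have := (SimpleGraph.isAcyclic_bot (V := Fin n)).ncard_edgeSet_add_card_connectedComponent
  simpa [numComponents, hbot] using this

theorem le_componentSum (G : WeightedGraph n w) (hw : 1 ≤ w) : n ≤ G.componentSum := by
  refine G.numComponents_zero.ge.trans ?_
  exact Finset.single_le_sum (f := G.numComponents) (fun _ _ => Nat.zero_le _)
    (Finset.mem_range.2 hw)

theorem EdgeNeighboring.symm {G H : WeightedGraph n w} (h : G.EdgeNeighboring H) :
    H.EdgeNeighboring G := by
  obtain ⟨e, he⟩ := h
  exact ⟨e, fun e' hne => ⟨(he e' hne).1.symm, fun h' =>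
    ((he e' hne).2 ((he e' hne).1.2 h')).symm⟩⟩

theorem EdgeNeighboring.componentSum_le {G H : WeightedGraph n w} (h : G.EdgeNeighboring H) :
    G.componentSum ≤ H.componentSum + w := by
  obtain ⟨e, he⟩ := h
  have : ∀ i ∈ Finset.range w, G.numComponents i ≤ H.numComponents i + 1 := by
    intro i _
    refine SimpleGraph.card_connectedComponent_le_succ (e := e) fun e' hne h' => ?_
    rw [mem_edgeSet_threshold] at h' ⊢
    have h1 := (he e' hne).1.2 h'.1
    exact ⟨h1, (he e' hne).2 h1 ▸ h'.2⟩
  refine (Finset.sum_le_sum this).trans ?_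
  rw [Finset.sum_add_distrib]
  simp [componentSum]

/-- The edges of `T` of weight at most `i`. -/
def lightEdges (G : WeightedGraph n w) (T : SimpleGraph (Fin n)) (i : ℕ) : Set (Sym2 (Fin n)) :=
  {e ∈ T.edgeSet | G.weight e ≤ i}

/-- Double counting: an edge of weight `x` is light at the `w - x` thresholds `x, …, w - 1`, so
weight and count add up to `w` for each edge. -/
theorem edgeWeight_eq_sum (G : WeightedGraph n w) {T : SimpleGraph (Fin n)} (hT : T ≤ G.graph) :
    G.edgeWeight T.edgeSet + ∑ i ∈ Finset.range w, (G.lightEdges T i).ncard =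
      w * T.edgeSet.ncard := by
  classical
  have h1 : ∀ i, (G.lightEdges T i).ncard =
      ∑ e ∈ T.edgeSet.toFinite.toFinset, if G.weight e ≤ i then 1 else 0 := by
    intro i
    rw [Finset.sum_boole, Nat.cast_id, Set.ncard_eq_toFinset_card _ (Set.toFinite _)]
    congr 1
    ext e
    simp [lightEdges]
  rw [edgeWeight, Finset.sum_congr rfl fun i _ => h1 i, Finset.sum_comm,
    ← Finset.sum_add_distrib, Set.ncard_eq_toFinset_card _ (Set.toFinite _), mul_comm,
    ← smul_eq_mul]
  refine Finset.sum_eq_card_nsmul fun e he => ?_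
  rw [Set.Finite.mem_toFinset] at he
  have hw := (G.weight_mem e (SimpleGraph.edgeSet_subset_edgeSet.2 hT he)).2
  rw [Finset.sum_boole, Nat.cast_id]
  have : (Finset.range w).filter (fun i => G.weight e ≤ i) = Finset.Ico (G.weight e) w := by
    ext i; simp [and_comm]
  rw [this, Nat.card_Ico]
  omega

theorem ncard_lightEdges_add_le (G : WeightedGraph n w) {T : SimpleGraph (Fin n)}
    (hT : T ≤ G.graph) (hA : T.IsAcyclic) (i : ℕ) :
    (G.lightEdges T i).ncard + G.numComponents i ≤ n := by
  have hle : T ⊓ G.threshold i ≤ G.threshold i := inf_le_right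
  have h := (hA.anti (inf_le_left : T ⊓ G.threshold i ≤ T)
    ).ncard_edgeSet_add_card_connectedComponent_le hle
  rw [Nat.card_fin] at h
  refine le_trans ?_ h
  refine Nat.add_le_add_right (Set.ncard_le_ncard ?_ (Set.toFinite _)) _
  rintro e ⟨he, hi⟩
  rw [SimpleGraph.edgeSet_inf]
  exact ⟨he, (G.mem_edgeSet_threshold i e).2 ⟨SimpleGraph.edgeSet_subset_edgeSet.2 hT he, hi⟩⟩

/-- Kruskal: there are nested spanning forests of the threshold graphs. -/
theorem exists_forest (G : WeightedGraph n w) (k : ℕ) :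
    ∃ T : SimpleGraph (Fin n), T ≤ G.threshold k ∧ T.IsAcyclic ∧
      T.Reachable = (G.threshold k).Reachable ∧
      ∀ i ≤ k, n ≤ (G.lightEdges T i).ncard + G.numComponents i := by
  have key : ∀ (i : ℕ) (T : SimpleGraph (Fin n)), T ≤ G.threshold i → T.IsAcyclic →
      T.Reachable = (G.threshold i).Reachable →
      n ≤ (G.lightEdges T i).ncard + G.numComponents i := by
    intro i T hle hA hR
    have h := hA.ncard_edgeSet_add_card_connectedComponent
    rw [SimpleGraph.card_connectedComponent_congr hR, Nat.card_fin] at h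
    have hsub : T.edgeSet ⊆ G.lightEdges T i := fun e he => ⟨he, ((G.mem_edgeSet_threshold i e).1
      (SimpleGraph.edgeSet_subset_edgeSet.2 hle he)).2⟩
    exact h.ge.trans (Nat.add_le_add_right (Set.ncard_le_ncard hsub (Set.toFinite _)) _)
  induction k with
  | zero =>
    obtain ⟨T, hle, hA, hR⟩ := (G.threshold 0).exists_isAcyclic_reachable_eq_le
    refine ⟨T, hle, hA, hR, fun i hi => ?_⟩
    obtain rfl : i = 0 := by omega
    exact key 0 T hle hA hR
  | succ k ih =>
    obtain ⟨T, hle, hA, hR, hT⟩ := ih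
    -- The forest is only ever enlarged, so the counts at earlier thresholds survive.
    obtain ⟨T', hTT', hle', hA', hR'⟩ :=
      SimpleGraph.exists_isAcyclic_reachable_eq_le_of_le_of_isAcyclic
        (hle.trans (G.threshold_mono (Nat.le_succ k))) hA
    refine ⟨T', hle', hA', hR', fun i hi => ?_⟩
    rcases Nat.lt_or_ge k i with h | h
    · obtain rfl : i = k + 1 := by omega
      exact key _ T' hle' hA' hR'
    · refine (hT i h).trans (Nat.add_le_add_right (Set.ncard_le_ncard ?_ (Set.toFinite _)) _)
      rintro e ⟨he, hi⟩
      exact ⟨SimpleGraph.edgeSet_subset_edgeSet.2 hTT' he, hi⟩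

/-- The weight of a minimum spanning tree in terms of the numbers of components of the
threshold graphs. -/
theorem mstWeight_add (G : WeightedGraph n w) (hG : G.graph.Connected) :
    G.mstWeight + w = G.componentSum := by
  classical
  have hn : ∀ T : SimpleGraph (Fin n), T.IsTree → T.edgeSet.ncard + 1 = n := by
    intro T hT
    have := hT.card_edgeFinset
    rwa [Fintype.card_fin, SimpleGraph.edgeFinset, ← Set.ncard_eq_toFinset_card'] at this
  -- A tree has at most `n - c_i` light edges at threshold `i`, and its weight is `w (n - 1)` minus
  -- the sum of these counts. The nested forests below attain equality at every threshold at once.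
  have hlow : ∀ T : SimpleGraph (Fin n), T ≤ G.graph → T.IsTree →
      G.componentSum ≤ G.edgeWeight T.edgeSet + w := by
    intro T hT hTree
    have h1 := G.edgeWeight_eq_sum hT
    have h2 : ∑ i ∈ Finset.range w, ((G.lightEdges T i).ncard + G.numComponents i) ≤ w * n := by
      refine (Finset.sum_le_sum fun i _ => G.ncard_lightEdges_add_le hT hTree.isAcyclic i).trans ?_
      simp
    rw [Finset.sum_add_distrib] at h2
    have h3 : w * T.edgeSet.ncard + w = w * n := by
      rw [← Nat.mul_succ, Nat.succ_eq_add_one, hn T hTree]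
    rw [componentSum]
    omega
  obtain ⟨T, hle, hA, hR, hT⟩ := G.exists_forest w
  rw [threshold_eq_graph] at hle hR
  have hTree : T.IsTree := by
    have := hG.nonempty
    exact ⟨⟨fun u v => by rw [hR]; exact hG.preconnected u v⟩, hA⟩
  have hup : G.edgeWeight T.edgeSet + w ≤ G.componentSum := by
    have h1 := G.edgeWeight_eq_sum hle
    have h2 : w * n ≤ ∑ i ∈ Finset.range w, ((G.lightEdges T i).ncard + G.numComponents i) := by
      refine le_trans ?_ (Finset.sum_le_sum fun i hi => hT i (Finset.mem_range.1 hi).le)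
      simp
    rw [Finset.sum_add_distrib] at h2
    have h3 : w * T.edgeSet.ncard + w = w * n := by
      rw [← Nat.mul_succ, Nat.succ_eq_add_one, hn T hTree]
    rw [componentSum]
    omega
  have hmem : G.edgeWeight T.edgeSet ∈ {m : ℕ | ∃ T : SimpleGraph (Fin n), T ≤ G.graph ∧
      T.IsTree ∧ m = G.edgeWeight T.edgeSet} := ⟨T, hle, hTree, rfl⟩
  apply le_antisymm
  · exact (Nat.add_le_add_right (Nat.sInf_le hmem) w).trans hup
  · obtain ⟨T', hT', hTree', h'⟩ := Nat.sInf_mem ⟨_, hmem⟩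
    rw [mstWeight, h']
    exact hlow T' hT' hTree'

end WeightedGraph

/-! ### Query programs -/

/-- Query programs with results in an arbitrary type. -/
inductive QueryProg (n : ℕ) (α : Type) : Type where
  | pure (x : α) : QueryProg n α
  | degree (v : Fin n) (next : ℕ → QueryProg n α) : QueryProg n α
  | neighbor (v i : Fin n) (next : Option (Fin n × ℕ) → QueryProg n α) : QueryProg n α

namespace QueryProg

variable {n w : ℕ} {α β : Type}

/-- The result on a given input. -/
def run {G : WeightedGraph n w} (L : G.AdjList) : QueryProg n α → α
  | pure x => x
  | degree v next => run L (next (L.degree v))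
  | neighbor v i next => run L (next (L.neighbor v i))

/-- The number of queries on a given input. -/
def cost {G : WeightedGraph n w} (L : G.AdjList) : QueryProg n α → ℕ
  | pure _ => 0
  | degree v next => cost L (next (L.degree v)) + 1
  | neighbor v i next => cost L (next (L.neighbor v i)) + 1

/-- Sequential composition. -/
def bind : QueryProg n α → (α → QueryProg n β) → QueryProg n β
  | pure x, f => f x
  | degree v next, f => degree v fun d => (next d).bind f
  | neighbor v i next, f => neighbor v i fun o => (next o).bind f

/-- The decision tree of a program that produces a value `x` and outputs `g x`. -/
def toTree (g : α → ℝ) : QueryProg n α → QueryTree n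
  | pure x => .output (g x)
  | degree v next => .degreeQuery v fun d => (next d).toTree g
  | neighbor v i next => .neighborQuery v i fun o => (next o).toTree g

variable {G : WeightedGraph n w} (L : G.AdjList)

theorem run_bind (p : QueryProg n α) (f : α → QueryProg n β) :
    (p.bind f).run L = (f (p.run L)).run L := by
  induction p with
  | pure x => rfl
  | degree v next ih => exact ih _
  | neighbor v i next ih => exact ih _

theorem cost_bind (p : QueryProg n α) (f : α → QueryProg n β) :
    (p.bind f).cost L = p.cost L + (f (p.run L)).cost L := by
  induction p with
  | pure x => simp [bind, cost, run]
  | degree v next ih => simp only [bind, cost, run, ih]; ring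
  | neighbor v i next ih => simp only [bind, cost, run, ih]; ring

theorem eval_toTree (g : α → ℝ) (p : QueryProg n α) : (p.toTree g).eval L = g (p.run L) := by
  induction p with
  | pure x => rfl
  | degree v next ih => exact ih _
  | neighbor v i next ih => exact ih _

theorem queries_toTree (g : α → ℝ) (p : QueryProg n α) :
    (p.toTree g).queries L = p.cost L := by
  induction p with
  | pure x => rfl
  | degree v next ih => exact congrArg (· + 1) (ih _)
  | neighbor v i next ih => exact congrArg (· + 1) (ih _)

/-- Run a family of programs and collect the results in a function. -/
def collect {ι : Type} [DecidableEq ι] (x₀ : α) (f : ι → QueryProg n α) :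
    List ι → QueryProg n (ι → α)
  | [] => pure fun _ => x₀
  | i :: l => (f i).bind fun a => (collect x₀ f l).bind fun g => pure (Function.update g i a)

theorem run_collect {ι : Type} [DecidableEq ι] (x₀ : α) (f : ι → QueryProg n α) (l : List ι)
    {i : ι} (hi : i ∈ l) : (collect x₀ f l).run L i = (f i).run L := by
  induction l with
  | nil => simp at hi
  | cons j l ih =>
    simp only [collect, run_bind, run]
    by_cases hij : i = j
    · subst hij; simp
    · rw [Function.update_of_ne hij]
      exact ih ((List.mem_cons.1 hi).resolve_left hij)

theorem cost_collect {ι : Type} [DecidableEq ι] (x₀ : α) (f : ι → QueryProg n α) (l : List ι) :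
    (collect x₀ f l).cost L = (l.map fun i => (f i).cost L).sum := by
  induction l with
  | nil => rfl
  | cons j l ih => simp [collect, cost_bind, cost, ih]

/-- Run a family of programs and add up the results. -/
def total {ι : Type} (f : ι → QueryProg n ℕ) : List ι → QueryProg n ℕ
  | [] => pure 0
  | i :: l => (f i).bind fun a => (total f l).bind fun b => pure (a + b)

theorem run_total {ι : Type} (f : ι → QueryProg n ℕ) (l : List ι) :
    (total f l).run L = (l.map fun i => (f i).run L).sum := by
  induction l with
  | nil => rfl
  | cons j l ih => simp [total, run_bind, run, ih]

theorem cost_total {ι : Type} (f : ι → QueryProg n ℕ) (l : List ι) :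
    (total f l).cost L = (l.map fun i => (f i).cost L).sum := by
  induction l with
  | nil => rfl
  | cons j l ih => simp [total, cost_bind, cost, ih]

/-! ### Exploring a component within a budget -/

/-- The neighbors of `v` along edges of weight at most `i` among the first `d` of its list. -/
def lightNeighbors (i : ℕ) (v : Fin n) : ℕ → QueryProg n (Finset (Fin n))
  | 0 => pure ∅
  | d + 1 =>
    if h : d < n then
      neighbor v ⟨d, h⟩ fun o => (lightNeighbors i v d).bind fun s =>
        pure (match o with
          | none => s
          | some (u, x) => if x ≤ i then insert u s else s)
    else lightNeighbors i v d

theorem cost_lightNeighbors_le (i : ℕ) (v : Fin n) (d : ℕ) :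
    (lightNeighbors i v d).cost L ≤ d := by
  induction d with
  | zero => exact le_rfl
  | succ d ih =>
    rw [lightNeighbors]
    split
    · simp only [cost, cost_bind]; omega
    · omega

theorem mem_run_lightNeighbors (i : ℕ) (v : Fin n) (d : ℕ) (u : Fin n) :
    u ∈ (lightNeighbors i v d).run L ↔
      ∃ j : Fin n, (j : ℕ) < d ∧ ∃ x ≤ i, L.neighbor v j = some (u, x) := by
  induction d with
  | zero => simp [lightNeighbors, run]
  | succ d ih =>
    rw [lightNeighbors]
    split
    · next h =>
      have hstep : (∃ j : Fin n, (j : ℕ) < d + 1 ∧ ∃ x ≤ i, L.neighbor v j = some (u, x)) ↔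
          (∃ x ≤ i, L.neighbor v ⟨d, h⟩ = some (u, x)) ∨
            ∃ j : Fin n, (j : ℕ) < d ∧ ∃ x ≤ i, L.neighbor v j = some (u, x) := by
        constructor
        · rintro ⟨j, hj, hx⟩
          rcases Nat.lt_succ_iff_lt_or_eq.1 hj with h' | h'
          · exact Or.inr ⟨j, h', hx⟩
          · obtain rfl : j = ⟨d, h⟩ := Fin.ext h'
            exact Or.inl hx
        · rintro (hx | ⟨j, hj, hx⟩)
          · exact ⟨⟨d, h⟩, Nat.lt_succ_self d, hx⟩
          · exact ⟨j, by omega, hx⟩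
      rw [hstep, ← ih]
      simp only [run, run_bind]
      cases ho : L.neighbor v ⟨d, h⟩ with
      | none => simp
      | some p =>
        obtain ⟨u', x⟩ := p
        simp only [Option.some.injEq, Prod.mk.injEq]
        split
        · next hx =>
          rw [Finset.mem_insert]
          refine or_congr ⟨fun h' => ⟨x, hx, h'.symm, rfl⟩, fun ⟨_, _, h', _⟩ => h'.symm⟩ Iff.rfl
        · next hx =>
          refine (or_iff_right ?_).symm
          rintro ⟨y, hy, -, rfl⟩
          exact hx hy
    · next h =>
      rw [ih]
      refine exists_congr fun j => ?_
      have := j.2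
      refine and_congr ?_ Iff.rfl
      omega

theorem mem_run_lightNeighbors_degree (i : ℕ) (v u : Fin n) :
    u ∈ (lightNeighbors i v (L.degree v)).run L ↔ (G.threshold i).Adj v u := by
  rw [mem_run_lightNeighbors]
  have hlen : L.degree v ≤ n := by
    simpa [WeightedGraph.AdjList.degree] using (L.nodup v).length_le_card
  constructor
  · rintro ⟨j, hj, x, hx, h⟩
    rw [WeightedGraph.AdjList.neighbor, Option.map_eq_some_iff] at h
    obtain ⟨u', hu', h⟩ := h
    rw [Prod.mk.injEq] at h
    obtain ⟨rfl, rfl⟩ := h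
    exact ⟨(L.mem_nbrs v u').1 (List.mem_of_getElem? hu'), hx⟩
  · rintro ⟨hadj, hx⟩
    obtain ⟨j, hj, hju⟩ := List.mem_iff_getElem.1 ((L.mem_nbrs v u).2 hadj)
    refine ⟨⟨j, hj.trans_le hlen⟩, hj, _, hx, ?_⟩
    rw [WeightedGraph.AdjList.neighbor]
    simp [hj, hju]

/-- Explore the component of the threshold graph, starting with the set `visited` of known
vertices, of which those in `done` have been processed and have volume `vol`. Return `1` if the
exploration is completed with volume at most `budget`, and `0` otherwise. -/
noncomputable def explore (i budget : ℕ) :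
    (fuel : ℕ) → (visited done : Finset (Fin n)) → (vol : ℕ) → QueryProg n ℕ
  | 0, _, _, _ => pure 0
  | fuel + 1, visited, done, vol =>
    if h : (visited \ done).Nonempty then
      degree h.choose fun d =>
        if budget < vol + (d + 1) then pure 0
        else (lightNeighbors i h.choose d).bind fun s =>
          explore i budget fuel (visited ∪ s) (insert h.choose done) (vol + (d + 1))
    else pure 1

/-- Processing `v` costs one degree query and at most `deg v` neighbor queries, which is what it
adds to `vol`. The extra `1` is the degree query that reveals an exceeded budget. -/
theorem cost_explore_add_le (i budget fuel : ℕ) (visited done : Finset (Fin n)) (vol : ℕ)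
    (hvol : vol ≤ budget) :
    (explore i budget fuel visited done vol).cost L + vol ≤ budget + 1 := by
  induction fuel generalizing visited done vol with
  | zero => simp only [explore, cost]; omega
  | succ fuel ih =>
    rw [explore]
    split
    · next h =>
      simp only [cost]
      split
      · simp only [cost]; omega
      · next hb =>
        rw [cost_bind]
        have h1 := cost_lightNeighbors_le L i h.choose (L.degree h.choose)
        have h2 := ih (visited ∪ (lightNeighbors i h.choose (L.degree h.choose)).run L)
          (insert h.choose done) (vol + (L.degree h.choose + 1)) (by omega)
        omega
    · simp only [cost]; omega

end QueryProg

namespace WeightedGraph.AdjList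

variable {n w : ℕ} {G : WeightedGraph n w}

open Classical in
/-- The volume (vertices plus degrees in the whole graph) of the component of `u` in the graph
of the edges of weight at most `i`. -/
noncomputable def componentVolume (L : G.AdjList) (i : ℕ) (u : Fin n) : ℕ :=
  ∑ v with (G.threshold i).Reachable u v, (L.degree v + 1)

end WeightedGraph.AdjList

namespace QueryProg

variable {n w : ℕ} {G : WeightedGraph n w} (L : G.AdjList)

/-- Loop invariant of a graph search. Each round enlarges `done`, so by `hfuel` the fuel cannot run
out. On rejection the processed vertices and the current one already lie in the component and exceed
the budget; on completion `done` is closed under adjacency and so is the whole component. -/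
theorem run_explore (i budget fuel : ℕ) (visited done : Finset (Fin n)) (vol : ℕ) (u : Fin n)
    (hu : u ∈ visited) (hdv : done ⊆ visited)
    (hreach : ∀ v ∈ visited, (G.threshold i).Reachable u v)
    (hclosed : ∀ v ∈ done, ∀ x, (G.threshold i).Adj v x → x ∈ visited)
    (hvol : vol = ∑ v ∈ done, (L.degree v + 1)) (hbudget : vol ≤ budget)
    (hfuel : n < fuel + done.card) :
    (explore i budget fuel visited done vol).run L =
      if L.componentVolume i u ≤ budget then 1 else 0 := by
  classical
  induction fuel generalizing visited done vol with
  | zero =>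
    have := done.card_le_univ
    rw [Fintype.card_fin] at this
    omega
  | succ fuel ih =>
    rw [explore]
    split
    · next h =>
      have hv := h.choose_spec
      set v := h.choose
      rw [Finset.mem_sdiff] at hv
      have hins : ∑ x ∈ insert v done, (L.degree x + 1) = vol + (L.degree v + 1) := by
        rw [Finset.sum_insert hv.2, hvol, add_comm]
      simp only [run]
      split
      · next hb =>
        rw [if_neg]
        · rfl
        rw [not_le]
        refine hb.trans_le ?_
        rw [← hins, WeightedGraph.AdjList.componentVolume]
        refine Finset.sum_le_sum_of_subset fun x hx => ?_
        rw [Finset.mem_filter]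
        refine ⟨Finset.mem_univ _, ?_⟩
        rcases Finset.mem_insert.1 hx with rfl | hx
        · exact hreach _ hv.1
        · exact hreach _ (hdv hx)
      · next hb =>
        rw [run_bind]
        refine ih _ _ _ (Finset.mem_union_left _ hu) ?_ ?_ ?_ hins.symm (by omega) ?_
        · exact Finset.insert_subset (Finset.mem_union_left _ hv.1)
            (hdv.trans Finset.subset_union_left)
        · intro x hx
          rcases Finset.mem_union.1 hx with hx | hx
          · exact hreach x hx
          · rw [mem_run_lightNeighbors_degree] at hx
            exact (hreach v hv.1).trans hx.reachable
        · intro x hx y hy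
          rcases Finset.mem_insert.1 hx with rfl | hx
          · exact Finset.mem_union_right _ ((mem_run_lightNeighbors_degree L i v y).2 hy)
          · exact Finset.mem_union_left _ (hclosed x hx y hy)
        · rw [Finset.card_insert_of_notMem hv.2]; omega
    · next h =>
      rw [Finset.not_nonempty_iff_eq_empty, Finset.sdiff_eq_empty_iff_subset] at h
      have hall : ∀ x y, (G.threshold i).Reachable x y → x ∈ visited → y ∈ visited := by
        rintro x y ⟨p⟩ hx
        induction p with
        | nil => exact hx
        | cons hadj _ ih => exact ih (hclosed _ (h hx) _ hadj)
      have heq : L.componentVolume i u = vol := by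
        rw [hvol, WeightedGraph.AdjList.componentVolume]
        refine Finset.sum_congr ?_ fun _ _ => rfl
        ext x
        rw [Finset.mem_filter]
        exact ⟨fun hx => h (hall u x hx.2 hu), fun hx => ⟨Finset.mem_univ _, hreach x (hdv hx)⟩⟩
      rw [heq, if_pos hbudget]
      rfl

end QueryProg

/-! ### The sampling estimator -/

/-- A set of at most `k` indices whose removal minimizes the sum of the others. -/
theorem exists_dropSet {ι : Type} [Fintype ι] [DecidableEq ι] (k : ℕ) (b : ι → ℕ) :
    ∃ J : Finset ι, J.card ≤ k ∧ ∀ J' : Finset ι, J'.card ≤ k →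
      ∑ i ∈ Jᶜ, b i ≤ ∑ i ∈ J'ᶜ, b i := by
  obtain ⟨J, hJ, hmin⟩ := Finset.exists_min_image
    (Finset.univ.filter fun J : Finset ι => J.card ≤ k) (fun J => ∑ i ∈ Jᶜ, b i) ⟨∅, by simp⟩
  exact ⟨J, (Finset.mem_filter.1 hJ).2, fun J' hJ' => hmin J' (by simpa using hJ')⟩

/-- A choice of at most `k` indices to be removed. -/
noncomputable def dropSet {ι : Type} [Fintype ι] [DecidableEq ι] (k : ℕ) (b : ι → ℕ) :
    Finset ι := (exists_dropSet k b).choose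

theorem card_dropSet_le {ι : Type} [Fintype ι] [DecidableEq ι] (k : ℕ) (b : ι → ℕ) :
    (dropSet k b).card ≤ k := (exists_dropSet k b).choose_spec.1

theorem sum_compl_dropSet_le {ι : Type} [Fintype ι] [DecidableEq ι] (k : ℕ) (b : ι → ℕ)
    (J : Finset ι) (hJ : J.card ≤ k) : ∑ i ∈ (dropSet k b)ᶜ, b i ≤ ∑ i ∈ Jᶜ, b i :=
  (exists_dropSet k b).choose_spec.2 J hJ

/-- The samples drawn by the estimator: for each threshold `i < w`, there are `r` pairs of a
vertex and a number in `{0, …, Q - 1}`. -/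
abbrev Samples (n w r Q : ℕ) : Type := Fin w × Fin r → Fin n × Fin Q

/-- The exploration budget of a sampled vertex. -/
def sampleBudget {n : ℕ} (Q : ℕ) (deg : Fin n → ℕ) (s : Fin n × Fin Q) : ℕ :=
  Q * (deg s.1 + 1) / ((s.2 : ℕ) + 1)

/-- Count the sampled vertices whose component can be explored within its budget, after
discarding `k` samples that have large budgets. -/
noncomputable def countProg {n w r Q : ℕ} (k : ℕ) (ω : Samples n w r Q) : QueryProg n ℕ :=
  (QueryProg.collect 0 (fun j => .degree (ω j).1 .pure) Finset.univ.toList).bind fun deg =>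
    QueryProg.total (fun j => QueryProg.explore j.1 (Q * (deg j + 1) / (((ω j).2 : ℕ) + 1)) (n + 1)
        {(ω j).1} ∅ 0)
      (dropSet k fun j => Q * (deg j + 1) / (((ω j).2 : ℕ) + 1))ᶜ.toList

section

variable {n w r Q : ℕ} {G : WeightedGraph n w} (L : G.AdjList)

/-- Whether a sample at threshold `i` counts. -/
noncomputable def hit (i : ℕ) (s : Fin n × Fin Q) : ℕ :=
  if L.componentVolume i s.1 ≤ sampleBudget Q L.degree s then 1 else 0

theorem run_collect_degree (ω : Samples n w r Q) :
    (QueryProg.collect 0 (fun j => QueryProg.degree (ω j).1 QueryProg.pure)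
      Finset.univ.toList).run L = fun j => L.degree (ω j).1 := by
  funext j
  rw [QueryProg.run_collect L _ _ _ (Finset.mem_toList.2 (Finset.mem_univ j))]
  rfl

theorem run_countProg (k : ℕ) (ω : Samples n w r Q) :
    (countProg k ω).run L =
      ∑ j ∈ (dropSet k fun j => sampleBudget Q L.degree (ω j))ᶜ, hit L j.1 (ω j) := by
  rw [countProg, QueryProg.run_bind, QueryProg.run_total, run_collect_degree, Finset.sum_map_toList]
  refine Finset.sum_congr rfl fun j _ => ?_
  rw [QueryProg.run_explore L _ _ _ _ _ _ (ω j).1 (by simp) (by simp) (by simp) (by simp) (by simp)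
    (by simp) (by simp)]
  rfl

/-- One `w * r` pays for the initial degree queries, the other for the one query by which each
exploration may overrun its budget. -/
theorem cost_countProg_le (k : ℕ) (ω : Samples n w r Q) :
    (countProg k ω).cost L ≤ 2 * (w * r) +
      ∑ j ∈ (dropSet k fun j => sampleBudget Q L.degree (ω j))ᶜ,
        sampleBudget Q L.degree (ω j) := by
  rw [countProg, QueryProg.cost_bind, QueryProg.cost_total, QueryProg.cost_collect,
    run_collect_degree, Finset.sum_map_toList, Finset.sum_map_toList]
  have h1 : ∑ j : Fin w × Fin r, (QueryProg.degree (ω j).1 QueryProg.pure).cost L = w * r := by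
    simp [QueryProg.cost]
  rw [h1, two_mul, add_assoc]
  refine Nat.add_le_add_left ?_ _
  have h2 : (dropSet k fun j => sampleBudget Q L.degree (ω j))ᶜ.card ≤ w * r := by
    refine (Finset.card_le_univ _).trans ?_
    simp
  refine le_trans (Finset.sum_le_sum fun j _ =>
    QueryProg.cost_explore_add_le L j.1 (sampleBudget Q L.degree (ω j)) (n + 1) {(ω j).1} ∅ 0
      (Nat.zero_le _)) ?_
  rw [Finset.sum_add_distrib, Finset.sum_const, smul_eq_mul, mul_one, add_comm]
  exact Nat.add_le_add_right h2 _

end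

/-! ### Realizing a finite randomized kernel by coins -/

/-- Nonnegative weights of total mass one on a finite type define a probability measure. -/
theorem exists_measure_of_weights {X : Type} [Fintype X] (W : X → ℝ) (hW : ∀ x, 0 ≤ W x)
    (hsum : ∑ x, W x = 1) :
    ∃ μ : @Measure X ⊤, @IsProbabilityMeasure X ⊤ μ ∧
      ∀ (S : Set X) [DecidablePred (· ∈ S)],
        @Measure.real X ⊤ μ S = ∑ x, if x ∈ S then W x else 0 := by
  classical
  let _ : MeasurableSpace X := ⊤
  let μ : Measure X := ∑ x, ENNReal.ofReal (W x) • Measure.dirac x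
  have hμ : ∀ (S : Set X) [DecidablePred (· ∈ S)], μ S =
      ENNReal.ofReal (∑ x, if x ∈ S then W x else 0) := by
    intro S _
    rw [ENNReal.ofReal_sum_of_nonneg fun x _ => by split <;> simp [hW]]
    simp only [μ, Measure.coe_finsetSum, Finset.sum_apply, Measure.smul_apply, smul_eq_mul]
    refine Finset.sum_congr rfl fun x _ => ?_
    rw [Measure.dirac_apply' _ (MeasurableSpace.measurableSet_top)]
    by_cases hx : x ∈ S <;> simp [hx]
  refine ⟨μ, ⟨by rw [hμ]; simp [hsum]⟩, fun S _ => ?_⟩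
  rw [Measure.real, hμ, ENNReal.toReal_ofReal]
  exact Finset.sum_nonneg fun x _ => by split <;> simp [hW]

/-- Marginals of a product of probability vectors. -/
theorem sum_prod_mul_apply {H O : Type} [Fintype H] [DecidableEq H] [Fintype O] (q : H → O → ℝ)
    (hq : ∀ h, ∑ o, q h o = 1) (h₀ : H) (F : O → ℝ) :
    ∑ g : H → O, (∏ h, q h (g h)) * F (g h₀) = ∑ o, q h₀ o * F o := by
  classical
  have h1 : ∀ g : H → O, (∏ h, q h (g h)) * F (g h₀) =
      ∏ h, q h (g h) * (if h = h₀ then F (g h) else 1) := by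
    intro g
    rw [Finset.prod_mul_distrib]
    simp
  rw [Finset.sum_congr rfl fun g _ => h1 g,
    ← Fintype.prod_sum fun h o => q h o * (if h = h₀ then F o else 1),
    Finset.prod_eq_single h₀]
  · simp
  · intro h _ hh
    simp [hh, hq]
  · simp

/-- Running a query program on uniform coins and passing the result through a finite randomized
kernel is a query algorithm. -/
theorem exists_queryAlgorithm {n w : ℕ} {Ω H O : Type} [Fintype Ω] [Nonempty Ω] [Fintype H]
    [DecidableEq H] [Fintype O] (prog : Ω → QueryProg n ℕ) (code : ℕ → H) (q : H → O → ℝ)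
    (hq : ∀ h o, 0 ≤ q h o) (hq1 : ∀ h, ∑ o, q h o = 1) (φ : O → ℝ) :
    ∃ A : QueryAlgorithm n w,
      (∀ (G : WeightedGraph n w) (L : G.AdjList) (S : Set ℝ) [DecidablePred (· ∈ S)],
        A.probOutput L S = (∑ ω, ∑ o, if φ o ∈ S then q (code ((prog ω).run L)) o else 0) /
          Fintype.card Ω) ∧
      ∀ (G : WeightedGraph n w) (L : G.AdjList) (b : ℝ),
        A.probQueriesLE L b =
          ((Finset.univ.filter fun ω => ((prog ω).cost L : ℝ) ≤ b).card : ℝ) / Fintype.card Ω := by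
  classical
  have hΩ : (0 : ℝ) < Fintype.card Ω := by exact_mod_cast Fintype.card_pos
  have hg1 : ∑ g : H → O, ∏ h, q h (g h) = 1 := by
    rw [← Fintype.prod_sum]
    exact Finset.prod_eq_one fun h _ => hq1 h
  -- The coins are a uniform `ω` and, independently for every possible code `h`, an output `g h`
  -- drawn from `q h` in advance; only the entry at the actual code is used.
  obtain ⟨μ, hμ, hμS⟩ := exists_measure_of_weights
    (fun x : Ω × (H → O) => (∏ h, q h (x.2 h)) / Fintype.card Ω)
    (fun x => div_nonneg (Finset.prod_nonneg fun h _ => hq _ _) hΩ.le) (by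
      rw [Fintype.sum_prod_type]
      simp only
      rw [Finset.sum_const, ← Finset.sum_div, hg1]
      simp [hΩ.ne'])
  refine ⟨⟨Ω × (H → O), ⊤, μ, hμ, fun x => (prog x.1).toTree fun m => φ (x.2 (code m)),
    fun _ _ => measurable_from_top, fun _ _ => measurable_from_top⟩, ?_, ?_⟩
  · intro G L S _
    rw [QueryAlgorithm.probOutput]
    simp only [QueryProg.eval_toTree]
    rw [hμS, Fintype.sum_prod_type, Finset.sum_div]
    refine Finset.sum_congr rfl fun ω _ => ?_
    have := sum_prod_mul_apply q hq1 (code ((prog ω).run L)) fun o => if φ o ∈ S then 1 else 0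
    simp only [mul_ite, mul_one, mul_zero] at this
    rw [← this, Finset.sum_div]
    refine Finset.sum_congr rfl fun g _ => ?_
    simp only [Set.mem_ofPred_eq]
    split <;> simp
  · intro G L b
    rw [QueryAlgorithm.probQueriesLE]
    simp only [QueryProg.queries_toTree]
    rw [hμS, Fintype.sum_prod_type, Finset.card_filter, Nat.cast_sum, Finset.sum_div]
    refine Finset.sum_congr rfl fun ω _ => ?_
    simp only [Set.mem_ofPred_eq]
    split
    · rw [← Finset.sum_div, hg1]; simp
    · simp

/-! ### Concentration by exponential moments -/

section Chernoff

variable {I V : Type} [Fintype I] [DecidableEq I] [Fintype V] [Nonempty V]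

theorem exp_mul_le_of_mem_Icc {t y : ℝ} (h0 : 0 ≤ y) (h1 : y ≤ 1) :
    Real.exp (t * y) ≤ 1 + (Real.exp t - 1) * y := by
  have := convexOn_exp.2 (Set.mem_univ 0) (Set.mem_univ t) (sub_nonneg.2 h1) h0 (by ring)
  simp only [smul_eq_mul, mul_zero, zero_add, Real.exp_zero] at this
  rw [mul_comm t y]
  linarith

/-- The moment generating function of a sum of independent variables with values in `[0, 1]`. -/
theorem sum_exp_le (Y : I → V → ℝ) (h0 : ∀ i v, 0 ≤ Y i v) (h1 : ∀ i v, Y i v ≤ 1) (t : ℝ) :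
    ∑ ω : I → V, Real.exp (t * ∑ i, Y i (ω i)) ≤
      Fintype.card (I → V) *
        Real.exp ((Real.exp t - 1) * ∑ i, (∑ v, Y i v) / Fintype.card V) := by
  have hV : (0 : ℝ) < Fintype.card V := by exact_mod_cast Fintype.card_pos
  have hprod : ∀ ω : I → V, Real.exp (t * ∑ i, Y i (ω i)) = ∏ i, Real.exp (t * Y i (ω i)) := by
    intro ω
    rw [Finset.mul_sum, Real.exp_sum]
  rw [Finset.sum_congr rfl fun ω _ => hprod ω,
    ← Fintype.prod_sum fun i v => Real.exp (t * Y i v), Fintype.card_fun, Finset.mul_sum,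
    Real.exp_sum, Nat.cast_pow, ← Finset.card_univ (α := I), ← Finset.prod_const,
    ← Finset.prod_mul_distrib]
  refine Finset.prod_le_prod (fun i _ => Finset.sum_nonneg fun v _ => (Real.exp_pos _).le)
    fun i _ => ?_
  refine (Finset.sum_le_sum fun v _ => exp_mul_le_of_mem_Icc (h0 i v) (h1 i v)).trans ?_
  rw [Finset.sum_add_distrib, ← Finset.mul_sum, Finset.sum_const, nsmul_eq_mul, mul_one,
    Finset.card_univ]
  have := Real.add_one_le_exp ((Real.exp t - 1) * ((∑ v, Y i v) / Fintype.card V))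
  calc (Fintype.card V : ℝ) + (Real.exp t - 1) * ∑ v, Y i v
      = Fintype.card V * ((Real.exp t - 1) * ((∑ v, Y i v) / Fintype.card V) + 1) := by
        field_simp; ring
    _ ≤ _ := mul_le_mul_of_nonneg_left this hV.le

/-- The exponential Markov inequality for such sums. -/
theorem card_le_mul_exp (Y : I → V → ℝ) (h0 : ∀ i v, 0 ≤ Y i v) (h1 : ∀ i v, Y i v ≤ 1)
    (t x : ℝ) (P : (I → V) → Prop) [DecidablePred P] (hP : ∀ ω, P ω → x ≤ t * ∑ i, Y i (ω i)) :
    ((Finset.univ.filter P).card : ℝ) ≤ Fintype.card (I → V) *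
      Real.exp ((Real.exp t - 1) * ∑ i, (∑ v, Y i v) / Fintype.card V - x) := by
  rw [Real.exp_sub, ← mul_div_assoc, le_div_iff₀ (Real.exp_pos _)]
  refine le_trans ?_ (sum_exp_le Y h0 h1 t)
  rw [← nsmul_eq_mul, ← Finset.sum_const]
  refine (Finset.sum_le_sum fun ω hω => ?_).trans
    (Finset.sum_le_sum_of_subset_of_nonneg (Finset.filter_subset P _)
      fun _ _ _ => (Real.exp_pos _).le)
  exact Real.exp_le_exp.2 (hP ω (Finset.mem_filter.1 hω).2)

/-- A two-sided Chernoff bound with mixed additive and multiplicative error. -/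
theorem card_deviation_le (Y : I → V → ℝ) (h0 : ∀ i v, 0 ≤ Y i v) (h1 : ∀ i v, Y i v ≤ 1)
    {γ ρ μ : ℝ} (hγ0 : 0 ≤ γ) (hγ1 : γ ≤ 1) (hμ : μ = ∑ i, (∑ v, Y i v) / Fintype.card V) :
    ((Finset.univ.filter fun ω : I → V =>
      γ * (ρ + μ) < |∑ i, Y i (ω i) - μ|).card : ℝ) ≤
        Fintype.card (I → V) * (2 * Real.exp (-(γ ^ 2 * ρ / 2))) := by
  classical
  have hμ0 : 0 ≤ μ := by
    rw [hμ]
    exact Finset.sum_nonneg fun i _ => div_nonneg (Finset.sum_nonneg fun v _ => h0 i v) (by simp)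
  -- With `t = ±γ / 2`, `exp t - 1 - t ≤ t ^ 2 = γ ^ 2 / 4`, and the term `γ ^ 2 μ / 2` from the
  -- deviation outweighs the resulting `γ ^ 2 μ / 4`.
  have hbound : ∀ t : ℝ, |t| = γ / 2 →
      (Real.exp t - 1) * μ - (t * μ + γ / 2 * (γ * (ρ + μ))) ≤ -(γ ^ 2 * ρ / 2) := by
    intro t ht
    have h := (abs_le.1 (Real.abs_exp_sub_one_sub_id_le (x := t) (by rw [ht]; linarith))).2
    have ht2 : t ^ 2 = γ ^ 2 / 4 := by rw [← sq_abs, ht]; ring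
    have h2 : (Real.exp t - 1 - t) * μ ≤ γ ^ 2 / 4 * μ :=
      mul_le_mul_of_nonneg_right (ht2 ▸ h) hμ0
    have h3 : 0 ≤ γ ^ 2 / 4 * μ := by positivity
    nlinarith
  have hup := card_le_mul_exp Y h0 h1 (γ / 2) (γ / 2 * μ + γ / 2 * (γ * (ρ + μ)))
    (fun ω => γ * (ρ + μ) < ∑ i, Y i (ω i) - μ) (fun ω h => by
      have := mul_le_mul_of_nonneg_left h.le (by positivity : 0 ≤ γ / 2)
      linarith)
  have hdown := card_le_mul_exp Y h0 h1 (-(γ / 2)) (-(γ / 2) * μ + γ / 2 * (γ * (ρ + μ)))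
    (fun ω => γ * (ρ + μ) < -(∑ i, Y i (ω i) - μ)) (fun ω h => by
      have := mul_le_mul_of_nonneg_left h.le (by positivity : 0 ≤ γ / 2)
      linarith)
  rw [← hμ] at hup hdown
  have hup' := hbound (γ / 2) (abs_of_nonneg (by positivity))
  have hdown' := hbound (-(γ / 2)) (by rw [abs_neg, abs_of_nonneg (by positivity)])
  have hsub : (Finset.univ.filter fun ω : I → V => γ * (ρ + μ) < |∑ i, Y i (ω i) - μ|) ⊆
      (Finset.univ.filter fun ω : I → V => γ * (ρ + μ) < ∑ i, Y i (ω i) - μ) ∪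
      (Finset.univ.filter fun ω : I → V => γ * (ρ + μ) < -(∑ i, Y i (ω i) - μ)) := by
    intro ω hω
    rw [Finset.mem_union, Finset.mem_filter, Finset.mem_filter]
    rw [Finset.mem_filter, lt_abs] at hω
    exact hω.2.imp (fun h => ⟨hω.1, h⟩) fun h => ⟨hω.1, h⟩
  have hcard : ((Finset.univ.filter fun ω : I → V =>
      γ * (ρ + μ) < |∑ i, Y i (ω i) - μ|).card : ℝ) ≤ _ :=
    (Nat.cast_le.2 ((Finset.card_le_card hsub).trans (Finset.card_union_le _ _))).trans
      (Nat.cast_add _ _).le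
  refine hcard.trans ((add_le_add hup hdown).trans ?_)
  rw [← mul_add, two_mul]
  gcongr

/-- Except with probability `exp (- k / 2)`, a sum of independent copies of a nonnegative variable
is at most four times its expectation, once the `k` largest summands are dropped. -/
theorem card_dropped_sum_le (b : V → ℝ) (hb : ∀ v, 0 < b v) [Nonempty I] {k : ℕ} (hk : 0 < k) :
    ((Finset.univ.filter fun ω : I → V => ¬ ∃ J : Finset I, J.card ≤ k ∧
      ∑ i ∈ Jᶜ, b (ω i) ≤ 4 * (Fintype.card I * ((∑ v, b v) / Fintype.card V))).card : ℝ) ≤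
        Fintype.card (I → V) * Real.exp (-(k / 2 : ℝ)) := by
  classical
  have hV : (0 : ℝ) < Fintype.card V := by exact_mod_cast Fintype.card_pos
  have hI : (0 : ℝ) < Fintype.card I := by exact_mod_cast Fintype.card_pos
  have hkr : (0 : ℝ) < k := by exact_mod_cast hk
  set m : ℝ := Fintype.card I * ((∑ v, b v) / Fintype.card V) with hm
  have hm0 : 0 < m := by
    have : 0 < ∑ v, b v := Finset.sum_pos (fun v _ => hb v) Finset.univ_nonempty
    positivity
  -- Truncation level: the values `min (b / t) 1` have expected total at most `m / t = k / 4`.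
  set t : ℝ := 4 * m / k with ht
  have ht0 : 0 < t := by positivity
  let Y : I → V → ℝ := fun _ v => min (b v / t) 1
  have hY0 : ∀ i v, 0 ≤ Y i v := fun _ v => le_min (div_nonneg (hb v).le ht0.le) zero_le_one
  have hY1 : ∀ i v, Y i v ≤ 1 := fun _ v => min_le_right _ _
  have hmean : ∑ i, (∑ v, Y i v) / Fintype.card V ≤ k / 4 := by
    have h1 : ∀ i : I, (∑ v, Y i v) / Fintype.card V ≤ (∑ v, b v) / t / Fintype.card V := by
      intro i
      rw [Finset.sum_div Finset.univ b t]
      gcongr with v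
      exact min_le_left _ _
    refine (Finset.sum_le_sum fun i _ => h1 i).trans_eq ?_
    rw [Finset.sum_const, nsmul_eq_mul, Finset.card_univ]
    have : (Fintype.card I : ℝ) * ((∑ v, b v) / t / Fintype.card V) = m / t := by
      rw [hm]; ring
    rw [this, ht]
    field_simp
  -- If the truncated total is below `k`, then at most `k` values exceed `t`; without them the sum
  -- is at most `t * k = 4 * m`.
  have hlow : ∀ ω : I → V, (¬ ∃ J : Finset I, J.card ≤ k ∧ ∑ i ∈ Jᶜ, b (ω i) ≤ 4 * m) →
      (k : ℝ) ≤ 1 * ∑ i, Y i (ω i) := by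
    intro ω
    contrapose!
    rw [one_mul]
    intro hlt
    refine ⟨Finset.univ.filter fun i => t < b (ω i), ?_, ?_⟩
    · have : ((Finset.univ.filter fun i => t < b (ω i)).card : ℝ) ≤ k := by
        refine le_trans ?_ hlt.le
        rw [Finset.card_filter, Nat.cast_sum]
        refine Finset.sum_le_sum fun i _ => ?_
        split
        · next h => exact le_min (by simpa using ((one_lt_div ht0).2 h).le) (by simp)
        · simpa using hY0 i (ω i)
      exact_mod_cast this
    · have h1 : ∀ i ∈ (Finset.univ.filter fun i => t < b (ω i))ᶜ, b (ω i) = t * Y i (ω i) := by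
        intro i hi
        rw [Finset.mem_compl, Finset.mem_filter, not_and, not_lt] at hi
        have : b (ω i) / t ≤ 1 := (div_le_one ht0).2 (hi (Finset.mem_univ i))
        simp only [Y, min_eq_left this]
        field_simp
      rw [Finset.sum_congr rfl h1, ← Finset.mul_sum]
      have h2 : 4 * m = t * k := by rw [ht]; field_simp
      rw [h2]
      refine mul_le_mul_of_nonneg_left (le_trans ?_ hlt.le) ht0.le
      exact Finset.sum_le_sum_of_subset_of_nonneg (Finset.subset_univ _) fun i _ _ => hY0 i _
  refine (card_le_mul_exp Y hY0 hY1 1 k _ hlow).trans ?_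
  gcongr
  have he := Real.exp_one_lt_three
  have h2 : (Real.exp 1 - 1) * ∑ i, (∑ v, Y i v) / Fintype.card V ≤ 2 * (k / 4) := by
    refine mul_le_mul (by linarith) hmean ?_ (by norm_num)
    exact Finset.sum_nonneg fun i _ => div_nonneg (Finset.sum_nonneg fun v _ => hY0 i v) hV.le
  linarith

end Chernoff

/-! ### Clamped geometric noise -/

/-- The two-sided geometric distribution with ratio `a` centered at `h`, clamped to
`{0, …, B}`. -/
noncomputable def geomKernel (a : ℝ) (B h k : ℕ) : ℝ :=
  (if k = 0 ∨ k = B then 1 else 1 - a) * a ^ ((k - h) + (h - k)) / (1 + a)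

section

variable {a : ℝ} {B h : ℕ}

theorem geomKernel_nonneg (ha0 : 0 ≤ a) (ha1 : a ≤ 1) (k : ℕ) : 0 ≤ geomKernel a B h k := by
  rw [geomKernel]
  have : 0 ≤ 1 - a := by linarith
  split <;> positivity

/-- The endpoint carries the whole geometric tail beyond it, so the partial sums telescope as if
there were no clamping. -/
theorem sum_geomKernel_lower (ha0 : 0 ≤ a) {j : ℕ} (hj : j < B) (hjh : j ≤ h) :
    ∑ k ∈ Finset.range (j + 1), geomKernel a B h k = a ^ (h - j) / (1 + a) := by
  induction j with
  | zero => simp [geomKernel]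
  | succ j ih =>
    rw [Finset.sum_range_succ, ih (by omega) (by omega), geomKernel, if_neg (by omega)]
    have h1 : (j + 1 - h) + (h - (j + 1)) = h - (j + 1) := by omega
    have h2 : h - j = (h - (j + 1)) + 1 := by omega
    rw [h1, h2, pow_succ]
    have : 1 + a ≠ 0 := by positivity
    field_simp
    ring

theorem sum_geomKernel_upper (ha0 : 0 ≤ a) {j : ℕ} (hj : 1 ≤ j) (hjB : j ≤ B) (hjh : h ≤ j) :
    ∑ k ∈ Finset.Ico j (B + 1), geomKernel a B h k = a ^ (j - h) / (1 + a) := by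
  induction d : B - j generalizing j with
  | zero =>
    obtain rfl : j = B := by omega
    simp [geomKernel, Nat.sub_eq_zero_of_le hjh]
  | succ d ih =>
    rw [Finset.sum_eq_sum_Ico_succ_bot (by omega), ih (by omega) (by omega) (by omega) (by omega),
      geomKernel, if_neg (by omega)]
    have h1 : (j - h) + (h - j) = j - h := by omega
    have h2 : j + 1 - h = (j - h) + 1 := by omega
    rw [h1, h2, pow_succ]
    have : 1 + a ≠ 0 := by positivity
    field_simp
    ring

theorem sum_geomKernel (ha0 : 0 ≤ a) (hB : 1 ≤ B) (hh : h ≤ B) :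
    ∑ k ∈ Finset.range (B + 1), geomKernel a B h k = 1 := by
  have hne : 1 + a ≠ 0 := by positivity
  have hself : geomKernel a B h h = (if h = 0 ∨ h = B then 1 else 1 - a) / (1 + a) := by
    simp [geomKernel]
  rcases Nat.eq_zero_or_pos h with rfl | hpos
  · rw [Finset.range_eq_Ico, Finset.sum_eq_sum_Ico_succ_bot (by omega),
      sum_geomKernel_upper ha0 (by omega) (by omega) (by omega), hself]
    simp only [true_or, if_true]
    field_simp
    simp
  obtain ⟨j, rfl⟩ : ∃ j, h = j + 1 := ⟨h - 1, by omega⟩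
  have hlow := sum_geomKernel_lower (B := B) (h := j + 1) ha0 (j := j) (by omega) (by omega)
  rw [Nat.add_sub_cancel_left, pow_one] at hlow
  rcases eq_or_lt_of_le hh with rfl | hlt
  · rw [Finset.sum_range_succ, hlow, hself]
    simp only [or_true, if_true]
    field_simp
    ring
  · rw [← Finset.sum_range_add_sum_Ico _ (by omega : j + 1 ≤ B + 1), hlow,
      Finset.sum_eq_sum_Ico_succ_bot (by omega), hself, if_neg (by omega),
      sum_geomKernel_upper ha0 (by omega) (by omega) (by omega)]
    rw [Nat.add_sub_cancel_left, pow_one]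
    field_simp
    ring

theorem geomKernel_le_one (ha0 : 0 ≤ a) (ha1 : a ≤ 1) (hB : 1 ≤ B) (hh : h ≤ B) {k : ℕ}
    (hk : k ≤ B) : geomKernel a B h k ≤ 1 := by
  rw [← sum_geomKernel ha0 hB hh]
  exact Finset.single_le_sum (f := geomKernel a B h)
    (fun k _ => geomKernel_nonneg ha0 ha1 k) (Finset.mem_range.2 (by omega))

/-- Moving the center by at most `m` changes the probabilities by at most a factor `a ^ m`. -/
theorem geomKernel_mul_pow_le (ha0 : 0 ≤ a) (ha1 : a ≤ 1) {h' m : ℕ} (h1 : h ≤ h' + m)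
    (h2 : h' ≤ h + m) (k : ℕ) : geomKernel a B h k * a ^ m ≤ geomKernel a B h' k := by
  rw [geomKernel, geomKernel, div_mul_eq_mul_div, mul_assoc, ← pow_add]
  have : 0 ≤ 1 - a := by linarith
  have hpow : a ^ ((k - h) + (h - k) + m) ≤ a ^ ((k - h') + (h' - k)) :=
    pow_le_pow_of_le_one ha0 ha1 (by omega)
  gcongr

theorem sum_geomKernel_tail_le (ha0 : 0 ≤ a) {T : ℕ} (hT : 1 ≤ T) (hh : h ≤ B) :
    (∑ k ∈ Finset.range (B + 1), if h + T ≤ k ∨ k + T ≤ h then geomKernel a B h k else 0) ≤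
      2 * a ^ T / (1 + a) := by
  rw [← Finset.sum_filter]
  have hsplit : (Finset.range (B + 1)).filter (fun k => h + T ≤ k ∨ k + T ≤ h) =
      (Finset.Ico (h + T) (B + 1)) ∪ Finset.range (h + 1 - T) := by
    ext k
    simp only [Finset.mem_filter, Finset.mem_union, Finset.mem_range, Finset.mem_Ico]
    omega
  rw [hsplit, Finset.sum_union]
  · have hpos : 0 ≤ a ^ T / (1 + a) := by positivity
    have h1 : ∑ k ∈ Finset.Ico (h + T) (B + 1), geomKernel a B h k ≤ a ^ T / (1 + a) := by
      rcases Nat.lt_or_ge B (h + T) with hlt | hle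
      · rw [Finset.Ico_eq_empty (by omega)]; simpa using hpos
      · rw [sum_geomKernel_upper ha0 (by omega) hle (by omega), Nat.add_sub_cancel_left]
    have h2 : ∑ k ∈ Finset.range (h + 1 - T), geomKernel a B h k ≤ a ^ T / (1 + a) := by
      rcases Nat.lt_or_ge h T with hlt | hle
      · rw [Nat.sub_eq_zero_of_le (by omega)]; simpa using hpos
      · have : h + 1 - T = (h - T) + 1 := by omega
        rw [this, sum_geomKernel_lower ha0 (by omega) (by omega), Nat.sub_sub_self hle]
    rw [two_mul, add_div]
    exact add_le_add h1 h2
  · rw [Finset.disjoint_left]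
    intro k hk
    rw [Finset.mem_Ico] at hk
    rw [Finset.mem_range]
    omega

end

/-! ### Accuracy and cost of the sampling estimator -/

section

variable {n w r Q : ℕ} {G : WeightedGraph n w} (L : G.AdjList)

namespace WeightedGraph.AdjList

theorem succ_degree_le_componentVolume (i : ℕ) (u : Fin n) :
    L.degree u + 1 ≤ L.componentVolume i u := by
  classical
  exact Finset.single_le_sum (f := fun v => L.degree v + 1) (fun _ _ => Nat.zero_le _)
    (by simp)

theorem componentVolume_pos (i : ℕ) (u : Fin n) : 0 < L.componentVolume i u :=
  (Nat.succ_pos _).trans_le (L.succ_degree_le_componentVolume i u)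

/-- Weighting every vertex by its share of the volume of its component counts components. -/
theorem sum_degree_div_componentVolume (i : ℕ) :
    ∑ u, ((L.degree u + 1 : ℕ) : ℝ) / L.componentVolume i u = G.numComponents i := by
  classical
  rw [← Finset.sum_fiberwise Finset.univ (fun u => (G.threshold i).connectedComponentMk u)]
  have hone : ∀ C : (G.threshold i).ConnectedComponent,
      ∑ u with (G.threshold i).connectedComponentMk u = C,
        ((L.degree u + 1 : ℕ) : ℝ) / L.componentVolume i u = 1 := by
    intro C
    induction C using SimpleGraph.ConnectedComponent.ind with | _ x
    have hvol : ∀ u, (G.threshold i).connectedComponentMk u =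
        (G.threshold i).connectedComponentMk x →
        L.componentVolume i u = L.componentVolume i x := by
      intro u hu
      have hux := SimpleGraph.ConnectedComponent.exact hu
      rw [componentVolume, componentVolume]
      refine Finset.sum_congr (Finset.filter_congr fun v _ => ?_) fun _ _ => rfl
      exact ⟨hux.symm.trans, hux.trans⟩
    rw [Finset.sum_congr rfl fun u hu => by rw [hvol u (Finset.mem_filter.1 hu).2],
      ← Finset.sum_div, div_eq_one_iff_eq (by exact_mod_cast (L.componentVolume_pos i x).ne'),
      ← Nat.cast_sum, componentVolume]
    congr 1
    refine Finset.sum_congr (Finset.filter_congr fun v _ => ?_) fun _ _ => rfl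
    rw [SimpleGraph.ConnectedComponent.eq]
    exact SimpleGraph.reachable_comm
  rw [Finset.sum_congr rfl fun C _ => hone C]
  simp [numComponents]

theorem sum_succ_degree : ∑ v, ((L.degree v + 1 : ℕ) : ℝ) = 2 * G.graph.edgeSet.ncard + n := by
  classical
  have hdeg : ∀ v, L.degree v = G.graph.degree v := by
    intro v
    rw [degree, ← List.toFinset_card_of_nodup (L.nodup v), ← SimpleGraph.card_neighborFinset_eq_degree]
    congr 1
    ext u
    simp [L.mem_nbrs]
  have h := G.graph.sum_degrees_eq_twice_card_edges
  rw [SimpleGraph.edgeFinset, ← Set.ncard_eq_toFinset_card'] at h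
  rw [← Nat.cast_sum, Finset.sum_add_distrib, Finset.sum_congr rfl fun v _ => hdeg v, h]
  simp

end WeightedGraph.AdjList

/-- The number of hits of a fixed vertex. -/
theorem sum_hit_vertex (i : ℕ) (u : Fin n) :
    ∑ a : Fin Q, hit L i (u, a) = Q * (L.degree u + 1) / L.componentVolume i u := by
  set v := L.componentVolume i u with hv
  have hvpos : 0 < v := L.componentVolume_pos i u
  have hle : Q * (L.degree u + 1) / v ≤ Q := by
    refine Nat.div_le_of_le_mul ?_
    rw [mul_comm]
    exact Nat.mul_le_mul_right _ (L.succ_degree_le_componentVolume i u)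
  -- Both conditions say `(a + 1) * v ≤ Q * (deg u + 1)`.
  have hterm : ∀ a : Fin Q, hit L i (u, a) =
      if (a : ℕ) < Q * (L.degree u + 1) / v then 1 else 0 := by
    intro a
    rw [hit, sampleBudget]
    refine if_congr ?_ rfl rfl
    rw [← hv, Nat.le_div_iff_mul_le (Nat.succ_pos _), Nat.lt_iff_add_one_le,
      Nat.le_div_iff_mul_le hvpos, mul_comm]
  rw [Finset.sum_congr rfl fun a _ => hterm a,
    Fin.sum_univ_eq_sum_range (fun a => if a < Q * (L.degree u + 1) / v then 1 else 0) Q,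
    Finset.sum_boole, Nat.cast_id]
  have : (Finset.range Q).filter (fun a => a < Q * (L.degree u + 1) / v) =
      Finset.range (Q * (L.degree u + 1) / v) := by
    ext a
    simp only [Finset.mem_filter, Finset.mem_range]
    omega
  rw [this, Finset.card_range]

theorem sum_hit_le (i : ℕ) :
    ∑ s : Fin n × Fin Q, (hit L i s : ℝ) ≤ Q * G.numComponents i := by
  rw [Fintype.sum_prod_type, ← L.sum_degree_div_componentVolume, Finset.mul_sum]
  refine Finset.sum_le_sum fun u _ => ?_
  rw [← Nat.cast_sum, sum_hit_vertex, ← mul_div_assoc, ← Nat.cast_mul]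
  exact Nat.cast_div_le

/-- Rounding down the number of hits loses at most one for each vertex. -/
theorem le_sum_hit (i : ℕ) :
    Q * (G.numComponents i : ℝ) - n ≤ ∑ s : Fin n × Fin Q, (hit L i s : ℝ) := by
  rw [Fintype.sum_prod_type, ← L.sum_degree_div_componentVolume, Finset.mul_sum]
  have : (n : ℝ) = ∑ _u : Fin n, (1 : ℝ) := by simp
  rw [this, ← Finset.sum_sub_distrib]
  refine Finset.sum_le_sum fun u _ => ?_
  rw [← Nat.cast_sum, sum_hit_vertex, ← mul_div_assoc, ← Nat.cast_mul, sub_le_iff_le_add]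
  have hpos : (0 : ℝ) < L.componentVolume i u := by exact_mod_cast L.componentVolume_pos i u
  rw [div_le_iff₀ hpos]
  have h := Nat.lt_div_mul_add (a := Q * (L.degree u + 1)) (L.componentVolume_pos i u)
  have h' : Q * (L.degree u + 1) ≤
      (Q * (L.degree u + 1) / L.componentVolume i u + 1) * L.componentVolume i u := by
    rw [add_mul, one_mul]; exact h.le
  exact_mod_cast h'

theorem hit_le_one (i : ℕ) (s : Fin n × Fin Q) : hit L i s ≤ 1 := by
  rw [hit]; split <;> simp

theorem run_countProg_le (k : ℕ) (ω : Samples n w r Q) :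
    (countProg k ω).run L ≤ ∑ j, hit L j.1 (ω j) := by
  rw [run_countProg]
  exact Finset.sum_le_sum_of_subset (Finset.subset_univ _)

theorem le_run_countProg (k : ℕ) (ω : Samples n w r Q) :
    ∑ j, hit L j.1 (ω j) ≤ (countProg k ω).run L + k := by
  rw [run_countProg, ← Finset.sum_compl_add_sum (dropSet k fun j => sampleBudget Q L.degree (ω j))]
  refine Nat.add_le_add_left ?_ _
  refine (Finset.sum_le_card_nsmul _ _ 1 fun j _ => hit_le_one L _ _).trans ?_
  rw [smul_eq_mul, mul_one]
  exact card_dropSet_le _ _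

/-- The scaled count estimates the component sum. -/
theorem card_bad_estimate_le {γ : ℝ} (hγ0 : 0 < γ) (hγ1 : γ ≤ 1) (hn : 0 < n) (hw : 1 ≤ w)
    (hr : 0 < r) (hQ : 0 < Q) {k : ℕ} (hk : (k : ℝ) ≤ γ * r) (hwQ : (w : ℝ) ≤ γ * Q) :
    ((Finset.univ.filter fun ω : Samples n w r Q =>
      4 * γ * (G.componentSum : ℝ) <
        |n * (((countProg k ω).run L : ℕ) : ℝ) / r - G.componentSum|).card : ℝ) ≤
      Fintype.card (Samples n w r Q) * (2 * Real.exp (-(γ ^ 2 * r / 2))) := by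
  classical
  have : Nonempty (Fin n × Fin Q) := ⟨⟨0, hn⟩, ⟨0, hQ⟩⟩
  have hnr : (0 : ℝ) < n := by exact_mod_cast hn
  have hrr : (0 : ℝ) < r := by exact_mod_cast hr
  have hQr : (0 : ℝ) < Q := by exact_mod_cast hQ
  let Y : Fin w × Fin r → Fin n × Fin Q → ℝ := fun j s => hit L j.1 s
  set μ : ℝ := ∑ j, (∑ s, Y j s) / Fintype.card (Fin n × Fin Q) with hμ
  set F : ℝ := (G.componentSum : ℝ) with hF
  have hnF : (n : ℝ) ≤ F := Nat.cast_le.2 (G.le_componentSum hw)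
  have hcard : (Fintype.card (Fin n × Fin Q) : ℝ) = n * Q := by simp
  have hsum : n * μ / r = ∑ i ∈ Finset.range w, (∑ s : Fin n × Fin Q, (hit L i s : ℝ)) / Q := by
    rw [hμ, Fintype.sum_prod_type, hcard, ← Fin.sum_univ_eq_sum_range
      (fun i => (∑ s : Fin n × Fin Q, (hit L i s : ℝ)) / Q)]
    simp only [Y, Finset.sum_const, Finset.card_univ, Fintype.card_fin, nsmul_eq_mul]
    rw [← Finset.mul_sum, Finset.mul_sum, Finset.mul_sum, Finset.sum_div]
    refine Finset.sum_congr rfl fun i _ => ?_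
    field_simp
  have hFsum : F = ∑ i ∈ Finset.range w, (G.numComponents i : ℝ) := by
    rw [hF, WeightedGraph.componentSum, Nat.cast_sum]
  have hup : n * μ / r ≤ F := by
    rw [hsum, hFsum]
    refine Finset.sum_le_sum fun i _ => ?_
    rw [div_le_iff₀ hQr, mul_comm]
    exact sum_hit_le L i
  have hlow : F - γ * n ≤ n * μ / r := by
    have h1 : ∑ i ∈ Finset.range w, ((G.numComponents i : ℝ) - n / Q) ≤ n * μ / r := by
      rw [hsum]
      refine Finset.sum_le_sum fun i _ => ?_
      rw [le_div_iff₀ hQr, sub_mul, div_mul_cancel₀ _ hQr.ne', mul_comm]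
      exact le_sum_hit L i
    rw [Finset.sum_sub_distrib, ← hFsum] at h1
    refine le_trans ?_ h1
    have h2 : (w : ℝ) * (n / Q) ≤ γ * n := by
      rw [mul_div_assoc', div_le_iff₀ hQr]
      nlinarith
    rw [Finset.sum_const, Finset.card_range, nsmul_eq_mul]
    linarith
  -- After scaling by `n / r`, the deviation with `ρ = r` is `γ (n + n μ / r) ≤ 2 γ F`. Rounding and
  -- discarding cost `γ n ≤ γ F` each, for a total of `4 γ F`.
  have hY := card_deviation_le Y (fun j s => Nat.cast_nonneg _)
    (fun j s => Nat.cast_le_one.2 (hit_le_one L _ _)) (ρ := r) hγ0.le hγ1 hμ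
  refine le_trans (Nat.cast_le.2 (Finset.card_le_card fun ω hω => ?_)) hY
  rw [Finset.mem_filter] at hω ⊢
  refine ⟨Finset.mem_univ _, ?_⟩
  by_contra hcon
  rw [not_lt, abs_le] at hcon
  refine absurd hω.2 (not_lt.2 ?_)
  have h1 : (((countProg k ω).run L : ℕ) : ℝ) ≤ ∑ j, Y j (ω j) := by
    simp only [Y]
    exact_mod_cast run_countProg_le L k ω
  have h2 : ∑ j, Y j (ω j) ≤ (((countProg k ω).run L : ℕ) : ℝ) + k := by
    simp only [Y]
    exact_mod_cast le_run_countProg L k ω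
  have hup' : (((countProg k ω).run L : ℕ) : ℝ) ≤ μ + γ * (r + μ) := by linarith [hcon.2]
  have hlow' : μ - γ * (r + μ) - γ * r ≤ (((countProg k ω).run L : ℕ) : ℝ) := by linarith [hcon.1]
  have hnr' : (0 : ℝ) ≤ n / r := by positivity
  have e1 : n / r * (μ + γ * (r + μ)) = n * μ / r + γ * (n + n * μ / r) := by
    field_simp
  have e2 : n / r * (μ - γ * (r + μ) - γ * r) = n * μ / r - γ * (n + n * μ / r) - γ * n := by
    field_simp
  have e3 : n * (((countProg k ω).run L : ℕ) : ℝ) / r = n / r * (((countProg k ω).run L : ℕ) : ℝ) := by ring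
  have g1 := mul_le_mul_of_nonneg_left hup' hnr'
  have g2 := mul_le_mul_of_nonneg_left hlow' hnr'
  rw [e1] at g1
  rw [e2] at g2
  have m1 := mul_le_mul_of_nonneg_left hup hγ0.le
  have m2 := mul_le_mul_of_nonneg_left hnF hγ0.le
  rw [e3, abs_le]
  constructor <;> linarith

theorem sampleBudget_pos (deg : Fin n → ℕ) (s : Fin n × Fin Q) : 0 < sampleBudget Q deg s := by
  rw [sampleBudget]
  refine Nat.div_pos ?_ (Nat.succ_pos _)
  have := s.2.2
  nlinarith

/-- The budget is a product of a factor in `u` and `1 / (a + 1)` up to rounding: the first sums to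
the total volume, the second to a harmonic number. -/
theorem sum_sampleBudget_le :
    ∑ s : Fin n × Fin Q, (sampleBudget Q L.degree s : ℝ) ≤
      Q * ((2 * G.graph.edgeSet.ncard + n) * (1 + Real.log Q)) := by
  have h1 : ∀ s : Fin n × Fin Q, (sampleBudget Q L.degree s : ℝ) ≤
      Q * (((L.degree s.1 + 1 : ℕ) : ℝ) * ((s.2 : ℕ) + 1 : ℝ)⁻¹) := by
    intro s
    refine Nat.cast_div_le.trans_eq ?_
    push_cast
    ring
  refine (Finset.sum_le_sum fun s _ => h1 s).trans ?_
  rw [← Finset.mul_sum, Fintype.sum_prod_type]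
  simp only
  rw [← Finset.sum_mul_sum, L.sum_succ_degree]
  have h2 : ∑ a : Fin Q, ((a : ℕ) + 1 : ℝ)⁻¹ ≤ 1 + Real.log Q := by
    rw [Fin.sum_univ_eq_sum_range (fun a => ((a : ℝ) + 1)⁻¹)]
    refine le_trans (le_of_eq ?_) (harmonic_le_one_add_log Q)
    rw [harmonic]
    push_cast
    rfl
  gcongr

/-- The number of queries of the estimator. -/
theorem card_expensive_le (hn : 0 < n) (hw : 1 ≤ w) (hr : 0 < r) (hQ : 0 < Q) {k : ℕ}
    (hk : 0 < k) {b : ℝ}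
    (hb : 2 * (w * r) + 4 * (w * r * ((G.avgDegree + 1) * (1 + Real.log Q))) ≤ b) :
    ((Finset.univ.filter fun ω : Samples n w r Q =>
      ¬ ((countProg k ω).cost L : ℝ) ≤ b).card : ℝ) ≤
      Fintype.card (Samples n w r Q) * Real.exp (-(k / 2 : ℝ)) := by
  classical
  have : Nonempty (Fin n × Fin Q) := ⟨⟨0, hn⟩, ⟨0, hQ⟩⟩
  have : Nonempty (Fin w × Fin r) := ⟨⟨0, hw⟩, ⟨0, hr⟩⟩
  have hnr : (0 : ℝ) < n := by exact_mod_cast hn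
  have hQr : (0 : ℝ) < Q := by exact_mod_cast hQ
  have h := card_dropped_sum_le (I := Fin w × Fin r)
    (fun s : Fin n × Fin Q => (sampleBudget Q L.degree s : ℝ))
    (fun s => by exact_mod_cast sampleBudget_pos L.degree s) hk
  refine le_trans (Nat.cast_le.2 (Finset.card_le_card fun ω hω => ?_)) h
  rw [Finset.mem_filter] at hω ⊢
  refine ⟨Finset.mem_univ _, ?_⟩
  rintro ⟨J, hJ, hsum⟩
  refine hω.2 (le_trans ?_ hb)
  have h1 : ((countProg k ω).cost L : ℝ) ≤ 2 * (w * r) +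
      ∑ j ∈ Jᶜ, (sampleBudget Q L.degree (ω j) : ℝ) := by
    exact_mod_cast (cost_countProg_le L k ω).trans
      (Nat.add_le_add_left (sum_compl_dropSet_le k _ J hJ) _)
  refine h1.trans (add_le_add le_rfl (hsum.trans ?_))
  have hcard : (Fintype.card (Fin n × Fin Q) : ℝ) = n * Q := by simp
  have hcard' : (Fintype.card (Fin w × Fin r) : ℝ) = w * r := by simp
  rw [hcard, hcard']
  gcongr
  rw [div_le_iff₀ (by positivity)]
  refine (sum_sampleBudget_le L).trans_eq ?_
  rw [WeightedGraph.avgDegree]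
  field_simp

end

/-! ### The logarithmic scale -/

/-- The change of scale that turns an error `w + β x` at `x` into an error at most one. -/
noncomputable def logScale (β w x : ℝ) : ℝ := Real.log (1 + β * x / w) / β

section

variable {β w x : ℝ}

theorem exp_mul_logScale (hβ : 0 < β) (hw : 0 < w) (hx : 0 ≤ x) :
    Real.exp (β * logScale β w x) = 1 + β * x / w := by
  rw [logScale, mul_div_cancel₀ _ hβ.ne', Real.exp_log (by positivity)]

theorem logScale_nonneg (hβ : 0 < β) (hw : 0 < w) (hx : 0 ≤ x) : 0 ≤ logScale β w x := by
  refine div_nonneg (Real.log_nonneg ?_) hβ.le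
  have : 0 ≤ β * x / w := by positivity
  linarith

theorem logScale_le (hβ : 0 < β) (hw : 0 < w) (hx : 0 ≤ x) : logScale β w x ≤ x / w := by
  rw [logScale, div_le_iff₀ hβ]
  have h : 0 < 1 + β * x / w := by positivity
  refine (Real.log_le_sub_one_of_pos h).trans_eq ?_
  ring

/-- After exponentiation this reads `w + β x ≤ exp β * (w + β x')`: the factor `exp β ≥ 1 + β + β ^
2 / 2` covers the sensitivity `w` as well as both relative errors `β / 4`. -/
theorem logScale_le_add_one (hβ0 : 0 < β) (hβ1 : β ≤ 1) (hw : 0 < w) {x' F F' : ℝ}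
    (hx0 : 0 ≤ x) (hx'0 : 0 ≤ x') (hF' : 0 ≤ F') (hFF : F ≤ F' + w)
    (hx : |x - F| ≤ β / 4 * F) (hx' : |x' - F'| ≤ β / 4 * F') :
    logScale β w x ≤ logScale β w x' + 1 := by
  have key : w + β * x ≤ Real.exp β * (w + β * x') := by
    have h1 : x ≤ (1 + β / 4) * (F' + w) := by
      have : (1 + β / 4) * F ≤ (1 + β / 4) * (F' + w) :=
        mul_le_mul_of_nonneg_left hFF (by positivity)
      linarith [(abs_le.1 hx).2]
    have h2 : (1 - β / 4) * F' ≤ x' := by linarith [(abs_le.1 hx').1]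
    have he : 1 + β + β ^ 2 / 2 ≤ Real.exp β := Real.quadratic_le_exp_of_nonneg hβ0.le
    have h3 : (1 + β + β ^ 2 / 2) * (w + β * ((1 - β / 4) * F')) ≤
        Real.exp β * (w + β * x') := by
      have : 0 ≤ 1 - β / 4 := by linarith
      gcongr
    refine le_trans ?_ h3
    have h4 : w + β * x ≤ w + β * ((1 + β / 4) * (F' + w)) := by gcongr
    refine h4.trans ?_
    have hβF : 0 ≤ β * F' := by positivity
    have e : (1 + β + β ^ 2 / 2) * (w + β * ((1 - β / 4) * F')) -
        (w + β * ((1 + β / 4) * (F' + w))) =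
        β ^ 2 / 4 * w + β * F' * (β / 2 + β ^ 2 / 4 * (1 - β / 2)) := by ring
    have h5 : 0 ≤ β ^ 2 / 4 * w + β * F' * (β / 2 + β ^ 2 / 4 * (1 - β / 2)) := by
      have : 0 ≤ 1 - β / 2 := by linarith
      positivity
    linarith
  have hle : Real.exp (β * logScale β w x) ≤ Real.exp (β * (logScale β w x' + 1)) := by
    rw [mul_add, mul_one, Real.exp_add, exp_mul_logScale hβ0 hw hx0, exp_mul_logScale hβ0 hw hx'0]
    have e1 : 1 + β * x / w = (w + β * x) / w := by field_simp
    have e2 : (1 + β * x' / w) * Real.exp β = Real.exp β * (w + β * x') / w := by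
      field_simp
    rw [e1, e2]
    gcongr
  exact le_of_mul_le_mul_left (Real.exp_le_exp.1 hle) hβ0

/-- The inverse change of scale, applied close to the scaled estimate. -/
theorem abs_unscale_sub_le {α κ s M : ℝ} (hβ0 : 0 < β) (hw : 0 < w) (hα : α < 1)
    (hβα : β ≤ α / 4) (hs : 0 ≤ s) (hsα : β * s ≤ α / 8) (hwM : w ≤ M) (hx0 : 0 ≤ x)
    (hx : |x - (M + w)| ≤ β / 4 * (M + w)) (hκ : |κ - logScale β w x| ≤ s) :
    |w / β * (Real.exp (β * κ) - 1) - w - M| ≤ α * M + 4 / 3 * (w * s) := by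
  set t := β * s with ht
  have ht0 : 0 ≤ t := by positivity
  have hα0 : 0 < α := by linarith
  have hM : 0 < M := hw.trans_le hwM
  have hup : Real.exp (β * κ) ≤ (1 + β * x / w) * (1 + 5 / 4 * t) := by
    have h1 : β * κ ≤ β * logScale β w x + t := by
      have : β * κ ≤ β * (logScale β w x + s) :=
        mul_le_mul_of_nonneg_left (by linarith [(abs_le.1 hκ).2]) hβ0.le
      linarith
    -- Here `t ≤ α / 8 < 1 / 4`, so the quadratic error `t ^ 2` is at most `t / 4`.
    have h2 : Real.exp t ≤ 1 + 5 / 4 * t := by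
      have h := (abs_le.1 (Real.abs_exp_sub_one_sub_id_le (x := t)
        (by rw [abs_of_nonneg ht0]; linarith))).2
      nlinarith
    refine (Real.exp_le_exp.2 h1).trans ?_
    rw [Real.exp_add, exp_mul_logScale hβ0 hw hx0]
    gcongr
  have hlow : (1 + β * x / w) * (1 - t) ≤ Real.exp (β * κ) := by
    have h1 : β * logScale β w x + -t ≤ β * κ := by
      have : β * (logScale β w x - s) ≤ β * κ :=
        mul_le_mul_of_nonneg_left (by linarith [(abs_le.1 hκ).1]) hβ0.le
      linarith
    refine le_trans ?_ (Real.exp_le_exp.2 h1)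
    rw [Real.exp_add, exp_mul_logScale hβ0 hw hx0]
    have := Real.add_one_le_exp (-t)
    gcongr
    linarith
  have hwβ : 0 ≤ w / β := by positivity
  have hws : w / β * t = w * s := by rw [ht]; field_simp
  have hws0 : 0 ≤ w * s := by positivity
  have hup' : w / β * (Real.exp (β * κ) - 1) ≤ 5 / 4 * (w * s) + x * (1 + 5 / 4 * t) := by
    refine (mul_le_mul_of_nonneg_left (sub_le_sub_right hup 1) hwβ).trans_eq ?_
    rw [← hws]
    field_simp
    ring
  have hlow' : -(w * s) + x * (1 - t) ≤ w / β * (Real.exp (β * κ) - 1) := by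
    refine le_trans (le_of_eq ?_) (mul_le_mul_of_nonneg_left (sub_le_sub_right hlow 1) hwβ)
    rw [← hws]
    field_simp
    ring
  have hxu : x * (1 + 5 / 4 * t) ≤ (1 + α / 2) * (M + w) := by
    have h1 : x ≤ (1 + β / 4) * (M + w) := by linarith [(abs_le.1 hx).2]
    have h2 : (1 + β / 4) * (1 + 5 / 4 * t) ≤ 1 + α / 2 := by nlinarith
    calc x * (1 + 5 / 4 * t) ≤ (1 + β / 4) * (M + w) * (1 + 5 / 4 * t) := by gcongr
      _ = (1 + β / 4) * (1 + 5 / 4 * t) * (M + w) := by ring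
      _ ≤ _ := by gcongr
  have hxl : (1 - α / 2) * (M + w) ≤ x * (1 - t) := by
    have h1 : (1 - β / 4) * (M + w) ≤ x := by linarith [(abs_le.1 hx).1]
    have h2 : 1 - α / 2 ≤ (1 - β / 4) * (1 - t) := by nlinarith
    have h3 : 0 ≤ 1 - t := by linarith
    calc (1 - α / 2) * (M + w) ≤ (1 - β / 4) * (1 - t) * (M + w) := by gcongr
      _ = (1 - β / 4) * (M + w) * (1 - t) := by ring
      _ ≤ _ := by gcongr
  -- The relative error `α / 2` refers to `M + w ≤ 2 * M`, which makes it `α` relative to `M`.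
  have hαw : α / 2 * w ≤ α / 2 * M := by gcongr
  rw [abs_le]
  constructor <;> linarith

end

/-! ### Mixing with the uniform distribution -/

/-- The clamped geometric kernel, mixed with the uniform distribution on `{0, …, B}`. -/
noncomputable def mixKernel (a p : ℝ) (B h k : ℕ) : ℝ :=
  (1 - p) * geomKernel a B h k + p / (B + 1)

section

variable {a p : ℝ} {B : ℕ}

theorem mixKernel_nonneg (ha0 : 0 ≤ a) (ha1 : a ≤ 1) (hp0 : 0 ≤ p) (hp1 : p ≤ 1) (h k : ℕ) :
    0 ≤ mixKernel a p B h k := by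
  have h1 := geomKernel_nonneg (B := B) (h := h) ha0 ha1 k
  have h2 : 0 ≤ 1 - p := by linarith
  rw [mixKernel]
  positivity

theorem sum_mixKernel (ha0 : 0 ≤ a) (hB : 1 ≤ B) {h : ℕ} (hh : h ≤ B) :
    ∑ k : Fin (B + 1), mixKernel a p B h k = 1 := by
  rw [Fin.sum_univ_eq_sum_range (fun k => mixKernel a p B h k)]
  simp only [mixKernel]
  rw [Finset.sum_add_distrib, ← Finset.mul_sum, sum_geomKernel ha0 hB hh]
  simp only [Finset.sum_const, Finset.card_range, nsmul_eq_mul]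
  push_cast
  field_simp
  ring

/-- Mixing with the uniform distribution absorbs a small failure probability of the sensitivity
bound. -/
theorem sum_mixKernel_le_mul {Ω : Type} [Fintype Ω] (ha0 : 0 < a) (ha1 : a ≤ 1)
    (hp1 : p ≤ 1) (hB : 1 ≤ B) {m : ℕ} {ε δ : ℝ} (ham : a ^ m = Real.exp (-ε))
    (hmix : (1 - p) * δ * (B + 1) ≤ (Real.exp ε - 1) * p)
    (h h' : Ω → ℕ) (hh : ∀ ω, h ω ≤ B) (bad : Finset Ω)
    (hbad : (bad.card : ℝ) ≤ Fintype.card Ω * δ)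
    (hgood : ∀ ω, ω ∉ bad → h ω ≤ h' ω + m ∧ h' ω ≤ h ω + m) {k : ℕ} (hk : k ≤ B) :
    ∑ ω, mixKernel a p B (h ω) k ≤ Real.exp ε * ∑ ω, mixKernel a p B (h' ω) k := by
  classical
  have hp : 0 ≤ 1 - p := by linarith
  have hpt : ∀ ω, geomKernel a B (h ω) k ≤
      Real.exp ε * geomKernel a B (h' ω) k + if ω ∈ bad then 1 else 0 := by
    intro ω
    have hnn := geomKernel_nonneg (B := B) (h := h' ω) ha0.le ha1 k
    split
    · have h1 := geomKernel_le_one ha0.le ha1 hB (hh ω) hk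
      have h2 : 0 ≤ Real.exp ε * geomKernel a B (h' ω) k := by positivity
      linarith
    · next hω =>
      obtain ⟨h1, h2⟩ := hgood ω hω
      have h3 := geomKernel_mul_pow_le (B := B) ha0.le ha1 h1 h2 k
      rw [ham] at h3
      have h4 := mul_le_mul_of_nonneg_left h3 (Real.exp_pos ε).le
      have h5 : Real.exp ε * Real.exp (-ε) = 1 := by rw [← Real.exp_add]; simp
      have h6 : Real.exp ε * (geomKernel a B (h ω) k * Real.exp (-ε)) =
          geomKernel a B (h ω) k := by
        rw [mul_comm (geomKernel a B (h ω) k), ← mul_assoc, h5, one_mul]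
      linarith
  have hsum : ∑ ω, geomKernel a B (h ω) k ≤
      Real.exp ε * ∑ ω, geomKernel a B (h' ω) k + Fintype.card Ω * δ := by
    refine (Finset.sum_le_sum fun ω _ => hpt ω).trans ?_
    rw [Finset.sum_add_distrib, ← Finset.mul_sum, Finset.sum_boole]
    simpa using hbad
  simp only [mixKernel]
  rw [Finset.sum_add_distrib, Finset.sum_add_distrib, ← Finset.mul_sum, ← Finset.mul_sum]
  simp only [Finset.sum_const, nsmul_eq_mul, Finset.card_univ]
  have h1 := mul_le_mul_of_nonneg_left hsum hp
  have hB1 : (0 : ℝ) < B + 1 := by positivity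
  -- The uniform part is the same on both sides, so the factor `exp ε` on the right leaves this much
  -- slack.
  have h2 : (1 - p) * δ ≤ (Real.exp ε - 1) * (p / (B + 1)) := by
    rw [mul_div_assoc', le_div_iff₀ hB1]
    exact hmix
  have h3 := mul_le_mul_of_nonneg_left h2 (Nat.cast_nonneg (α := ℝ) (Fintype.card Ω))
  linarith

/-- Union bound over three failures: the uniform part is chosen (`p`), the noise reaches `T` (`τ`),
the sample is bad (`δ`). -/
theorem le_sum_mixKernel {Ω : Type} [Fintype Ω] (ha0 : 0 ≤ a) (ha1 : a ≤ 1)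
    (hp0 : 0 ≤ p) (hp1 : p ≤ 1) (hB : 1 ≤ B) {T : ℕ} (hT : 1 ≤ T) {δ τ : ℝ}
    (hτ : 2 * a ^ T / (1 + a) ≤ τ) (h : Ω → ℕ) (hh : ∀ ω, h ω ≤ B) (bad : Finset Ω)
    (hbad : (bad.card : ℝ) ≤ Fintype.card Ω * δ) (S : ℕ → Prop) [DecidablePred S]
    (hgood : ∀ ω, ω ∉ bad → ∀ k ≤ B, k < h ω + T → h ω < k + T → S k) :
    Fintype.card Ω * (1 - p - τ - δ) ≤
      ∑ ω, ∑ k : Fin (B + 1), if S k then mixKernel a p B (h ω) k else 0 := by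
  classical
  have hp : 0 ≤ 1 - p := by linarith
  have hτ0 : 0 ≤ τ := le_trans (by positivity) hτ
  have hpt : ∀ ω, 1 - p - τ ≤
      (∑ k : Fin (B + 1), if S k then mixKernel a p B (h ω) k else 0) +
        if ω ∈ bad then 1 else 0 := by
    intro ω
    split
    · have : 0 ≤ ∑ k : Fin (B + 1), if S k then mixKernel a p B (h ω) k else 0 :=
        Finset.sum_nonneg fun k _ => by
          split
          · exact mixKernel_nonneg ha0 ha1 hp0 hp1 _ _
          · exact le_rfl
      linarith
    · next hω =>
      rw [Fin.sum_univ_eq_sum_range (fun k => if S k then mixKernel a p B (h ω) k else 0), add_zero]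
      have h1 : ∀ k ∈ Finset.range (B + 1), (1 - p) * (geomKernel a B (h ω) k -
          if h ω + T ≤ k ∨ k + T ≤ h ω then geomKernel a B (h ω) k else 0) ≤
          if S k then mixKernel a p B (h ω) k else 0 := by
        intro k hk
        have hnn := geomKernel_nonneg (B := B) (h := h ω) ha0 ha1 k
        have hmnn : 0 ≤ if S k then mixKernel a p B (h ω) k else 0 := by
          split
          · exact mixKernel_nonneg ha0 ha1 hp0 hp1 _ _
          · exact le_rfl
        split
        · simpa using hmnn
        · next hc =>
          rw [if_pos (hgood ω hω k (by simpa [Nat.lt_succ_iff] using hk) (by omega) (by omega)),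
            sub_zero, mixKernel]
          have : 0 ≤ p / ((B : ℝ) + 1) := by positivity
          linarith
      refine le_trans ?_ (Finset.sum_le_sum h1)
      rw [← Finset.mul_sum, Finset.sum_sub_distrib, sum_geomKernel ha0 hB (hh ω)]
      have h2 := (sum_geomKernel_tail_le (a := a) (B := B) ha0 hT (hh ω)).trans hτ
      have h3 := mul_le_mul_of_nonneg_left (sub_le_sub_left h2 1) hp
      refine le_trans ?_ h3
      nlinarith
  have hsum := Finset.sum_le_sum fun ω (_ : ω ∈ (Finset.univ : Finset Ω)) => hpt ω
  rw [Finset.sum_add_distrib, Finset.sum_boole, Finset.sum_const, nsmul_eq_mul,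
    Finset.card_univ] at hsum
  have hfil : Finset.univ.filter (fun ω => ω ∈ bad) = bad := by ext; simp
  rw [hfil] at hsum
  linarith

end

/-! ### The private estimator -/

/-- The position, on a logarithmic grid with `B + 1` points, of the estimate obtained from the
count `x`. -/
noncomputable def gridIndex (m B n w r : ℕ) (β : ℝ) (x : ℕ) : ℕ :=
  min ⌊(m : ℝ) * logScale β w (n * x / r)⌋₊ B

theorem gridIndex_le_add {m B n w r : ℕ} {β : ℝ} (hβ : 0 < β) (hw : 1 ≤ w) {x x' : ℕ}
    (h : logScale β w (n * x / r) ≤ logScale β w (n * x' / r) + 1) :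
    gridIndex m B n w r β x ≤ gridIndex m B n w r β x' + m := by
  have hwr : (0 : ℝ) < w := by exact_mod_cast hw
  have h0 : 0 ≤ (m : ℝ) * logScale β w (n * x' / r) :=
    mul_nonneg (Nat.cast_nonneg _) (logScale_nonneg hβ hwr (by positivity))
  have hfloor : ⌊(m : ℝ) * logScale β w (n * x / r)⌋₊ ≤
      ⌊(m : ℝ) * logScale β w (n * x' / r)⌋₊ + m := by
    rw [← Nat.floor_add_natCast h0]
    refine Nat.floor_le_floor ?_
    have := mul_le_mul_of_nonneg_left h (Nat.cast_nonneg (α := ℝ) m)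
    linarith
  rw [gridIndex, gridIndex]
  omega

theorem abs_sub_logScale_le {m n w r : ℕ} {β : ℝ} (hβ : 0 < β) (hw : 1 ≤ w) (hr : 0 < r)
    (hm : 0 < m) {x k T : ℕ} (hx : x ≤ w * r) (h1 : k < gridIndex m (m * n) n w r β x + T)
    (h2 : gridIndex m (m * n) n w r β x < k + T) :
    |(k : ℝ) / m - logScale β w (n * x / r)| ≤ T / m := by
  have hwr : (0 : ℝ) < w := by exact_mod_cast hw
  have hrr : (0 : ℝ) < r := by exact_mod_cast hr
  have hmr : (0 : ℝ) < m := by exact_mod_cast hm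
  have hx0 : (0 : ℝ) ≤ n * x / r := by positivity
  set f := logScale β w (n * x / r) with hf
  have hf0 : 0 ≤ f := logScale_nonneg hβ hwr hx0
  -- The count is at most `w * r`, so a grid up to `m * n` never clamps an estimate.
  have hfn : f ≤ n := by
    refine (logScale_le hβ hwr hx0).trans ?_
    rw [div_div, div_le_iff₀ (by positivity)]
    have : (x : ℝ) ≤ w * r := by exact_mod_cast hx
    calc (n : ℝ) * x ≤ n * (w * r) := by gcongr
      _ = n * (r * w) := by ring
  have hidx : gridIndex m (m * n) n w r β x = ⌊(m : ℝ) * f⌋₊ := by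
    rw [gridIndex, ← hf, min_eq_left]
    refine Nat.floor_le_of_le ?_
    push_cast
    gcongr
  rw [hidx] at h1 h2
  have hle := Nat.floor_le (mul_nonneg hmr.le hf0)
  have hlt := Nat.lt_floor_add_one ((m : ℝ) * f)
  have h1' : (k : ℝ) + 1 ≤ ⌊(m : ℝ) * f⌋₊ + T := by exact_mod_cast h1
  have h2' : (⌊(m : ℝ) * f⌋₊ : ℝ) + 1 ≤ k + T := by exact_mod_cast h2
  have e : (k : ℝ) / m - f = (k - m * f) / m := by field_simp
  rw [e, abs_div, abs_of_pos hmr]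
  gcongr
  rw [abs_le]
  constructor <;> linarith

theorem run_countProg_le_mul {n w r Q : ℕ} {G : WeightedGraph n w} (L : G.AdjList) (k : ℕ)
    (ω : Samples n w r Q) : (countProg k ω).run L ≤ w * r := by
  refine (run_countProg_le L k ω).trans ?_
  refine (Finset.sum_le_card_nsmul _ _ 1 fun j _ => hit_le_one L _ _).trans ?_
  simp

/-- The private estimator, with its parameters subject to the constraints that the analysis
uses. -/
theorem exists_private_estimator {n w r Q k m T : ℕ} {β ε p δ τ α s : ℝ} (hw : 1 ≤ w)
    (hwn : 2 * w < n) (hr : 0 < r) (hQ : 0 < Q) (hk0 : 0 < k) (hk : (k : ℝ) ≤ β / 16 * r)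
    (hwQ : (w : ℝ) ≤ β / 16 * Q) (hβ0 : 0 < β) (hβ1 : β ≤ 1) (hm : 0 < m) (hε : 0 < ε)
    (hp0 : 0 ≤ p) (hp1 : p ≤ 1) (hδ : 2 * Real.exp (-((β / 16) ^ 2 * r / 2)) ≤ δ)
    (hmix : (1 - p) * (2 * δ) * (m * n + 1) ≤ (Real.exp ε - 1) * p) (hT : 1 ≤ T)
    (hTs : (T : ℝ) ≤ m * s)
    (hτ : 2 * Real.exp (-(ε / m)) ^ T / (1 + Real.exp (-(ε / m))) ≤ τ) (hα : α < 1)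
    (hβα : β ≤ α / 4) (hsα : β * s ≤ α / 8) :
    ∃ A : QueryAlgorithm n w, A.IsEdgeDP ε ∧
      (∀ (G : WeightedGraph n w) (L : G.AdjList), G.graph.Connected → ∀ S : Set ℝ,
        Set.Icc ((1 - α) * (G.mstWeight : ℝ) - 4 / 3 * (w * s))
          ((1 + α) * (G.mstWeight : ℝ) + 4 / 3 * (w * s)) ⊆ S →
        1 - p - τ - δ ≤ A.probOutput L S) ∧
      ∀ (G : WeightedGraph n w) (L : G.AdjList) (b : ℝ),
        2 * (w * r) + 4 * (w * r * ((G.avgDegree + 1) * (1 + Real.log Q))) ≤ b →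
        1 - Real.exp (-(k / 2 : ℝ)) ≤ A.probQueriesLE L b := by
  classical
  have hn : 0 < n := by omega
  have hwr : (0 : ℝ) < w := by exact_mod_cast hw
  have hmr : (0 : ℝ) < m := by exact_mod_cast hm
  have hB : 1 ≤ m * n := Nat.mul_pos hm hn
  set a : ℝ := Real.exp (-(ε / m)) with ha
  have ha0 : 0 < a := Real.exp_pos _
  have ha1 : a ≤ 1 := Real.exp_le_one_iff.2 (by
    have : 0 ≤ ε / m := by positivity
    linarith)
  have ham : a ^ m = Real.exp (-ε) := by
    rw [ha, ← Real.exp_nat_mul]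
    congr 1
    field_simp
  have hs : 0 ≤ s := by
    by_contra hneg
    rw [not_le] at hneg
    have h1 := mul_neg_of_pos_of_neg hmr hneg
    have h2 : (0 : ℝ) ≤ T := Nat.cast_nonneg _
    linarith
  have : Nonempty (Samples n w r Q) := ⟨fun _ => (⟨0, hn⟩, ⟨0, hQ⟩)⟩
  have hcard : (0 : ℝ) < Fintype.card (Samples n w r Q) := by exact_mod_cast Fintype.card_pos
  let idx : ℕ → ℕ := gridIndex m (m * n) n w r β
  have hidx : ∀ x, idx x ≤ m * n := fun x => min_le_right _ _
  let code : ℕ → Fin (m * n + 1) := fun x => ⟨idx x, Nat.lt_succ_of_le (hidx x)⟩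
  -- The inverse of `logScale` at the grid point `j / m`, less `w` because the estimate is for `M +
  -- w`.
  let φ : ℕ → ℝ := fun j => w / β * (Real.exp (β * (j / m)) - 1) - w
  obtain ⟨A, hout, hquery⟩ := exists_queryAlgorithm (w := w)
    (fun ω : Samples n w r Q => countProg k ω) code
    (fun h j : Fin (m * n + 1) => mixKernel a p (m * n) h j)
    (fun h j => mixKernel_nonneg ha0.le ha1 hp0 hp1 _ _)
    (fun h => sum_mixKernel ha0.le hB (Nat.lt_succ_iff.1 h.2)) (fun j => φ j)
  let bad : (G : WeightedGraph n w) → G.AdjList → Finset (Samples n w r Q) := fun G L =>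
    Finset.univ.filter fun ω => 4 * (β / 16) * (G.componentSum : ℝ) <
      |n * (((countProg k ω).run L : ℕ) : ℝ) / r - G.componentSum|
  have hbad : ∀ (G : WeightedGraph n w) (L : G.AdjList),
      ((bad G L).card : ℝ) ≤ Fintype.card (Samples n w r Q) * δ := by
    intro G L
    refine (card_bad_estimate_le L (by positivity) (by linarith) hn hw hr hQ hk hwQ).trans ?_
    gcongr
  have hgood : ∀ (G : WeightedGraph n w) (L : G.AdjList) (ω : Samples n w r Q), ω ∉ bad G L →
      |n * (((countProg k ω).run L : ℕ) : ℝ) / r - G.componentSum| ≤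
        β / 4 * (G.componentSum : ℝ) := by
    intro G L ω hω
    have : ¬ _ := fun h => hω (Finset.mem_filter.2 ⟨Finset.mem_univ _, h⟩)
    rw [not_lt] at this
    linarith
  have hsens : ∀ (G H : WeightedGraph n w), G.EdgeNeighboring H → ∀ (L : G.AdjList)
      (L' : H.AdjList) (ω : Samples n w r Q), ω ∉ bad G L → ω ∉ bad H L' →
      idx ((countProg k ω).run L) ≤ idx ((countProg k ω).run L') + m := by
    intro G H hGH L L' ω h1 h2
    refine gridIndex_le_add hβ0 hw ?_
    refine logScale_le_add_one hβ0 hβ1 hwr (by positivity) (by positivity)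
      (Nat.cast_nonneg _) ?_ (hgood G L ω h1) (hgood H L' ω h2)
    exact_mod_cast hGH.componentSum_le
  refine ⟨A, ?_, ?_, ?_⟩
  · intro G H hGH L L' S _
    rw [hout, hout, ← mul_div_assoc]
    refine div_le_div_of_nonneg_right ?_ hcard.le
    rw [Finset.sum_comm, Finset.sum_comm (s := Finset.univ (α := Samples n w r Q)),
      Finset.mul_sum]
    refine Finset.sum_le_sum fun j _ => ?_
    split
    -- Both inputs run on the same coins, and either may be estimated badly, hence `2 * δ`.
    · refine sum_mixKernel_le_mul (δ := 2 * δ) (m := m) ha0 ha1 hp1 hB ham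
        (by push_cast; exact hmix) (fun ω => idx ((countProg k ω).run L))
        (fun ω => idx ((countProg k ω).run L')) (fun ω => hidx _) (bad G L ∪ bad H L') ?_ ?_
        (Nat.lt_succ_iff.1 j.2)
      · have h1 : (((bad G L ∪ bad H L').card : ℕ) : ℝ) ≤ (bad G L).card + (bad H L').card := by
          exact_mod_cast Finset.card_union_le _ _
        linarith [hbad G L, hbad H L']
      · intro ω hω
        rw [Finset.mem_union, not_or] at hω
        exact ⟨hsens G H hGH L L' ω hω.1 hω.2, hsens H G hGH.symm L' L ω hω.2 hω.1⟩
    · simp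
  · intro G L hG S hS
    rw [hout, le_div_iff₀ hcard, mul_comm]
    refine le_sum_mixKernel (B := m * n) ha0.le ha1 hp0 hp1 hB hT hτ
      (fun ω => idx ((countProg k ω).run L)) (fun ω => hidx _) (bad G L) (hbad G L)
      (fun j => φ j ∈ S) ?_
    intro ω hω j _ h1 h2
    refine hS ?_
    have hM : (G.componentSum : ℝ) = G.mstWeight + w := by
      exact_mod_cast (G.mstWeight_add hG).symm
    -- This is where `2 * w < n` enters: `M + w = F ≥ n`.
    have hwM : (w : ℝ) ≤ G.mstWeight := by
      have h3 := G.mstWeight_add hG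
      have h4 := G.le_componentSum hw
      have : w ≤ G.mstWeight := by omega
      exact_mod_cast this
    have hclose := hgood G L ω hω
    rw [hM] at hclose
    have hκ : |(j : ℝ) / m - logScale β w (n * (((countProg k ω).run L : ℕ) : ℝ) / r)| ≤ s := by
      refine (abs_sub_logScale_le hβ0 hw hr hm (run_countProg_le_mul L k ω) h1 h2).trans ?_
      rw [div_le_iff₀ hmr, mul_comm]
      exact hTs
    have h3 := abs_le.1 (abs_unscale_sub_le hβ0 hwr hα hβα hs hsα hwM (by positivity) hclose hκ)
    rw [Set.mem_Icc]
    constructor <;> simp only [φ] <;> linarith [h3.1, h3.2]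
  · intro G L b hb
    rw [hquery, le_div_iff₀ hcard]
    have h1 := card_expensive_le L hn hw hr hQ hk0 hb
    have h2 := Finset.card_filter_add_card_filter_not (s := Finset.univ (α := Samples n w r Q))
      (fun ω => ((countProg k ω).cost L : ℝ) ≤ b)
    have h3 : ((Finset.univ.filter fun ω : Samples n w r Q =>
        ((countProg k ω).cost L : ℝ) ≤ b).card : ℝ) + ((Finset.univ.filter fun ω :
          Samples n w r Q => ¬ ((countProg k ω).cost L : ℝ) ≤ b).card : ℝ) =
        Fintype.card (Samples n w r Q) := by
      exact_mod_cast h2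
    linarith

/-! ### Choice of parameters -/

theorem WeightedGraph.one_le_avgDegree {n w : ℕ} (G : WeightedGraph n w) (hn : 2 ≤ n)
    (hG : G.graph.Connected) : 1 ≤ G.avgDegree := by
  have h := hG.card_vert_le_card_edgeSet_add_one
  rw [Nat.card_fin, Nat.card_coe_set_eq] at h
  have hnr : (2 : ℝ) ≤ n := by exact_mod_cast hn
  have h' : (n : ℝ) ≤ G.graph.edgeSet.ncard + 1 := by exact_mod_cast h
  rw [WeightedGraph.avgDegree, le_div_iff₀ (by linarith)]
  linarith

theorem one_le_log_natCast {n : ℕ} (hn : 3 ≤ n) : 1 ≤ Real.log n := by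
  have h3 : (3 : ℝ) ≤ n := by exact_mod_cast hn
  rw [Real.le_log_iff_exp_le (by linarith)]
  linarith [Real.exp_one_lt_three]

/-- The tail of the geometric noise. -/
theorem geom_tail_le {c ε ℓ : ℝ} {m T : ℕ} (hm : 0 < m) (hε : 0 < ε) (hℓ : 1 ≤ ℓ)
    (hc : 0 < c) (hmc : 2 * ε / m ≤ c / 4) (hT : m * (3 / 2 * c * ℓ / ε) ≤ T + 1) :
    2 * Real.exp (-(ε / m)) ^ T / (1 + Real.exp (-(ε / m))) ≤
      Real.exp (-(c * ℓ)) * Real.exp (-(c / 4)) := by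
  have hmr : (0 : ℝ) < m := by exact_mod_cast hm
  have hεm : 0 < ε / m := by positivity
  set a := Real.exp (-(ε / m)) with ha
  have ha0 : 0 < a := Real.exp_pos _
  have ha1 : a ≤ 1 := Real.exp_le_one_iff.2 (by linarith)
  have h1 : 2 * a ^ T / (1 + a) ≤ a ^ T / a := by
    rw [div_le_div_iff₀ (by positivity) ha0]
    nlinarith [pow_pos ha0 T]
  refine h1.trans ?_
  rw [ha, ← Real.exp_nat_mul, ← Real.exp_sub, ← Real.exp_add, Real.exp_le_exp]
  -- The exponent satisfies `(T - 1) ε / m ≥ 3 c ℓ / 2 - 2 ε / m ≥ c ℓ + c / 4`, by `hmc` and `ℓ ≥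
  -- 1`.
  have h2 : ε / m * (m * (3 / 2 * c * ℓ / ε)) ≤ ε / m * (T + 1) := by gcongr
  have h3 : ε / m * (m * (3 / 2 * c * ℓ / ε)) = 3 / 2 * c * ℓ := by field_simp
  have h4 : 2 * ε / m = 2 * (ε / m) := by ring
  have h5 : c ≤ c * ℓ := le_mul_of_one_le_right hc.le hℓ
  nlinarith

/-- Absorbing the failure probability of the sampling in the mixture. -/
theorem mix_condition {c ε ℓ δ K n m E p : ℝ} (hK : 1 ≤ K) (hε : 0 < ε) (hm : 1 ≤ m)
    (hn : 1 ≤ n) (hℓ : n = Real.exp ℓ) (hδ0 : 0 ≤ δ)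
    (hδ : δ ≤ Real.exp (-(c * ℓ)) * (1 / (4 * m)))
    (hE : E = Real.exp ((c - 3) * ℓ) * (Real.exp ε - 1) / K) (hp : p = 1 / (E + 1)) :
    (1 - p) * (2 * δ) * (m * n + 1) ≤ (Real.exp ε - 1) * p := by
  have hε' : 0 < Real.exp ε - 1 := by linarith [Real.add_one_lt_exp hε.ne']
  have hE0 : 0 ≤ E := by rw [hE]; positivity
  have h1p : 1 - p = E * p := by rw [hp]; field_simp; ring
  have hp0 : 0 ≤ p := by rw [hp]; positivity
  have h1 : 2 * δ * (m * n + 1) ≤ Real.exp (-(c * ℓ)) * n := by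
    have hmn : 1 ≤ m * n := one_le_mul_of_one_le_of_one_le hm hn
    calc 2 * δ * (m * n + 1) ≤ 2 * (Real.exp (-(c * ℓ)) * (1 / (4 * m))) * (m * n + m * n) := by
          gcongr
      _ = Real.exp (-(c * ℓ)) * n := by field_simp; ring
  have h2 : E ≤ Real.exp ((c - 3) * ℓ) * (Real.exp ε - 1) := by
    rw [hE]
    exact div_le_self (by positivity) hK
  have h3 : Real.exp ((c - 3) * ℓ) * (Real.exp (-(c * ℓ)) * n) ≤ 1 := by
    rw [hℓ, ← Real.exp_add, ← Real.exp_add, Real.exp_le_one_iff]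
    have : 0 ≤ ℓ := by
      rw [hℓ] at hn
      exact Real.one_le_exp_iff.1 hn
    linarith
  have h4 : E * (2 * δ * (m * n + 1)) ≤ Real.exp ε - 1 := by
    have hn0 : 0 ≤ Real.exp (-(c * ℓ)) * n := by positivity
    calc E * (2 * δ * (m * n + 1)) ≤
        Real.exp ((c - 3) * ℓ) * (Real.exp ε - 1) * (Real.exp (-(c * ℓ)) * n) := by gcongr
      _ = (Real.exp ε - 1) * (Real.exp ((c - 3) * ℓ) * (Real.exp (-(c * ℓ)) * n)) := by ring
      _ ≤ (Real.exp ε - 1) * 1 := by gcongr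
      _ = _ := mul_one _
  calc (1 - p) * (2 * δ) * (m * n + 1) = E * (2 * δ * (m * n + 1)) * p := by rw [h1p]; ring
    _ ≤ _ := by gcongr

/-- The query bound of the estimator in terms of the parameters of the problem. -/
theorem query_bound {A D α ε ε₀ d ℓ w r Q γ : ℝ} (hA : 0 < A) (hD : 0 < D) (hα0 : 0 < α)
    (hα1 : α < 1) (hε0 : 0 < ε) (hε : ε ≤ ε₀) (hd : 1 ≤ d) (hℓ1 : 1 ≤ ℓ) (hℓ : 3 * ε₀ ≤ ℓ)
    (hw : 1 ≤ w) (hγ : γ = α * ε / (16 * A * ℓ)) (hγ1 : γ ≤ 1) (hr0 : 0 ≤ r)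
    (hr : r ≤ D * ℓ / γ ^ 2 + 1) (hQ0 : 0 < Q) (hQ : Q ≤ w / γ + 1) :
    2 * (w * r) + 4 * (w * r * ((d + 1) * (1 + Real.log Q))) ≤
      (D + 1) * (256 * A ^ 2) * (2 + 8 * (2 + |Real.log (32 * A)|)) *
        (d * w * (ℓ ^ 3 / (α ^ 2 * ε ^ 2)) * Real.log (d * w * ℓ / (α * ε))) := by
  have hγ0 : 0 < γ := by rw [hγ]; positivity
  have hr' : r ≤ (D + 1) * (256 * A ^ 2) * (ℓ ^ 3 / (α ^ 2 * ε ^ 2)) := by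
    have h1 : 1 ≤ ℓ / γ ^ 2 := by
      rw [le_div_iff₀ (by positivity), one_mul]
      exact (pow_le_one₀ hγ0.le hγ1).trans hℓ1
    have h2 : (D + 1) * (256 * A ^ 2) * (ℓ ^ 3 / (α ^ 2 * ε ^ 2)) = (D + 1) * (ℓ / γ ^ 2) := by
      rw [hγ]; field_simp; norm_num
    rw [h2]
    calc r ≤ D * ℓ / γ ^ 2 + 1 := hr
      _ ≤ D * ℓ / γ ^ 2 + ℓ / γ ^ 2 := by linarith
      _ = _ := by ring
  set X := d * w * ℓ / (α * ε) with hX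
  have hX0 : 0 < X := by positivity
  have hαε : α * ε ≤ ε₀ := by
    calc α * ε ≤ 1 * ε₀ := by gcongr
      _ = ε₀ := one_mul _
  -- From `ℓ ≥ 3 * ε₀`; then `log X ≥ 1` absorbs the constants added to logarithms.
  have hX3 : 3 ≤ X := by
    rw [hX, le_div_iff₀ (by positivity)]
    have : 1 ≤ d * w := one_le_mul_of_one_le_of_one_le hd hw
    nlinarith
  have hlogX : 1 ≤ Real.log X := by
    rw [Real.le_log_iff_exp_le hX0]
    linarith [Real.exp_one_lt_three]
  have hlogQ : 1 + Real.log Q ≤ (2 + |Real.log (32 * A)|) * Real.log X := by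
    have h1 : Q ≤ 32 * A * X := by
      have h2 : 1 ≤ w / γ := by
        rw [le_div_iff₀ hγ0]; linarith
      have h3 : 2 * (w / γ) = 32 * A * (1 * w * ℓ / (α * ε)) := by
        rw [hγ]; field_simp; ring
      calc Q ≤ 2 * (w / γ) := by linarith
        _ = 32 * A * (1 * w * ℓ / (α * ε)) := h3
        _ ≤ 32 * A * X := by rw [hX]; gcongr
    have h4 : Real.log Q ≤ Real.log (32 * A) + Real.log X := by
      rw [← Real.log_mul (by positivity) hX0.ne']
      exact Real.log_le_log hQ0 h1
    have h5 := le_abs_self (Real.log (32 * A))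
    have h6 := abs_nonneg (Real.log (32 * A))
    nlinarith
  set B := 2 + |Real.log (32 * A)| with hB
  have hB0 : 0 ≤ B := by positivity
  set R := (D + 1) * (256 * A ^ 2) * (ℓ ^ 3 / (α ^ 2 * ε ^ 2)) with hR
  have hR0 : 0 ≤ R := hr0.trans hr'
  have hdX : 1 ≤ d * Real.log X := one_le_mul_of_one_le_of_one_le hd hlogX
  have hwR : 0 ≤ w * R := by positivity
  have g1 : w * r ≤ w * R := by gcongr
  have g2 : (d + 1) * (1 + Real.log Q) ≤ 2 * d * (B * Real.log X) := by
    have hpos : 0 ≤ B * Real.log X := by positivity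
    calc (d + 1) * (1 + Real.log Q) ≤ (d + 1) * (B * Real.log X) := by gcongr
      _ ≤ 2 * d * (B * Real.log X) := by gcongr; linarith
  have g3 : w * r * ((d + 1) * (1 + Real.log Q)) ≤ w * R * (2 * d * (B * Real.log X)) := by
    calc w * r * ((d + 1) * (1 + Real.log Q)) ≤ w * r * (2 * d * (B * Real.log X)) := by gcongr
      _ ≤ _ := by gcongr
  have g4 : w * R ≤ w * R * (d * Real.log X) := le_mul_of_one_le_right hwR hdX
  calc 2 * (w * r) + 4 * (w * r * ((d + 1) * (1 + Real.log Q)))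
      ≤ 2 * (w * R * (d * Real.log X)) + 4 * (w * R * (2 * d * (B * Real.log X))) := by linarith
    _ = _ := by rw [hR]; ring

set_option maxHeartbeats 1000000 in
theorem mainTheorem7 (c ε₀ : ℝ) (hc : 0 < c) (hε₀ : 0 < ε₀) :
    ∃ C' : ℝ, 0 < C' ∧ ∃ C : ℝ, 0 < C ∧ ∃ N : ℕ,
      ∀ K : ℕ, 0 < K → ∀ ε : ℝ, 0 < ε → ε ≤ ε₀ → ∀ α : ℝ, 0 < α → α < 1 →
      ∀ n w : ℕ, 1 ≤ w → 2 * w < n →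
      ∃ A : QueryAlgorithm n w,
        -- privacy
        A.IsEdgeDP ε ∧
        -- accuracy
        (∀ (G : WeightedGraph n w) (L : G.AdjList), G.graph.Connected →
          1 - 1 / (n : ℝ) ^ c - 1 / ((n : ℝ) ^ (c - 3) * (Real.exp ε - 1) / (K : ℝ) + 1) ≤
            A.probOutput L (Set.Icc
              ((1 - α * (1 + ε / (C' * Real.log n))) * (G.mstWeight : ℝ)
                - 2 * c * w * Real.log n / ε - 1 / ((K : ℝ) * (n : ℝ) ^ 3))
              ((1 + α * (1 + ε / (C' * Real.log n))) * (G.mstWeight : ℝ)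
                + 2 * c * w * Real.log n / ε + 1 / ((K : ℝ) * (n : ℝ) ^ 3)))) ∧
        -- number of queries
        (N ≤ n → ∀ (G : WeightedGraph n w) (L : G.AdjList), G.graph.Connected →
          1 - 1 / (n : ℝ) ^ c ≤
            A.probQueriesLE L
              (C * (G.avgDegree * w * (Real.log n ^ 3 / (α ^ 2 * ε ^ 2)) *
                Real.log (G.avgDegree * w * Real.log n / (α * ε))))) := by
  -- The mesh is fine enough that rounding to the grid costs only `2 ε / m ≤ c / 4` in the noise
  -- tail.
  obtain ⟨m, hm⟩ := exists_nat_gt (max 1 (8 * ε₀ / c))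
  rw [max_lt_iff] at hm
  have hm1 : (1 : ℝ) ≤ m := hm.1.le
  have hmpos : 0 < m := by exact_mod_cast zero_lt_one.trans hm.1
  have hκ : 0 < 1 - Real.exp (-(c / 4)) := by
    have : Real.exp (-(c / 4)) < 1 := Real.exp_lt_one_iff.2 (by linarith)
    linarith
  -- The first bound on `exp (-D)` lets noise tail and sampling failure together stay below `n ^
  -- (-c)`; the second is for `mix_condition`.
  obtain ⟨D, hD1, hDκ, hDm⟩ : ∃ D : ℝ, 1 ≤ D ∧ 2 * Real.exp (-D) ≤ 1 - Real.exp (-(c / 4)) ∧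
      2 * Real.exp (-D) ≤ 1 / (4 * m) := by
    have h : Filter.Tendsto (fun D : ℝ => 2 * Real.exp (-D)) Filter.atTop (nhds 0) := by
      simpa using Real.tendsto_exp_neg_atTop_nhds_zero.const_mul 2
    have h4m : (0 : ℝ) < 1 / (4 * m) := by positivity
    exact ((Filter.eventually_ge_atTop 1).and ((h.eventually_le_const hκ).and
      (h.eventually_le_const h4m))).exists
  -- The first summand gives `β ≤ α / 4`, the second `β * s ≤ α / 8`.
  set A : ℝ := 4 * ε₀ + 12 * c with hA
  have hA0 : 0 < A := by positivity
  clear_value A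
  refine ⟨1, one_pos, (2 * (c + D) + 1) * (256 * A ^ 2) * (2 + 8 * (2 + |Real.log (32 * A)|)),
    by positivity, ⌈Real.exp (3 * ε₀)⌉₊, ?_⟩
  intro K hK ε hε0 hε α hα0 hα1 n w hw hwn
  have hn3 : 3 ≤ n := by omega
  have hnr : (0 : ℝ) < n := by positivity
  set ℓ := Real.log n with hℓ
  have hℓ1 : 1 ≤ ℓ := one_le_log_natCast hn3
  have hnexp : (n : ℝ) = Real.exp ℓ := (Real.exp_log hnr).symm
  have hrpow : ∀ x : ℝ, (n : ℝ) ^ x = Real.exp (x * ℓ) := fun x => by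
    rw [Real.rpow_def_of_pos hnr, mul_comm]
  clear_value ℓ
  have hwr : (1 : ℝ) ≤ w := by exact_mod_cast hw
  have hK1 : (1 : ℝ) ≤ K := by exact_mod_cast hK
  set β := α * ε / (A * ℓ) with hβ
  have hβ0 : 0 < β := by positivity
  have hβα : β ≤ α / 4 := by
    rw [hβ, div_le_iff₀ (by positivity)]
    have : 4 * ε ≤ A * ℓ := by nlinarith
    nlinarith
  set γ := β / 16 with hγ
  have hγ0 : 0 < γ := by positivity
  have hγ1 : γ ≤ 1 := by linarith
  clear_value β γ
  have hcD : 0 < c + D := by linarith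
  set r := ⌈2 * (c + D) * ℓ / γ ^ 2⌉₊ with hr
  have hrle : 2 * (c + D) * ℓ / γ ^ 2 ≤ r := Nat.le_ceil _
  have hr0 : 0 < r := Nat.ceil_pos.2 (by positivity)
  set Q := ⌈w / γ⌉₊ with hQ
  have hQ0 : 0 < Q := Nat.ceil_pos.2 (by positivity)
  set k := ⌊γ * r⌋₊ with hk
  have hγr : 2 * (c + D) * ℓ ≤ γ * r := by
    have h1 : γ * (2 * (c + D) * ℓ / γ ^ 2) ≤ γ * r := by gcongr
    have h2 : γ * (2 * (c + D) * ℓ / γ ^ 2) = 2 * (c + D) * ℓ / γ := by field_simp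
    have h3 : 2 * (c + D) * ℓ ≤ 2 * (c + D) * ℓ / γ := by
      rw [le_div_iff₀ hγ0]
      exact mul_le_of_le_one_right (by positivity) hγ1
    linarith
  -- The term `2 * D * ℓ ≥ 2` of `hγr` pays for the floor; hence `exp (-k / 2) ≤ n ^ (-c)`.
  have hkc : 2 * (c * ℓ) ≤ (k : ℝ) - 1 / 2 := by
    have h1 := Nat.lt_floor_add_one (γ * r)
    rw [← hk] at h1
    nlinarith
  have hk0 : 0 < k := by
    have : 0 < c * ℓ := by positivity
    exact_mod_cast (by linarith : (0 : ℝ) < k)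
  -- Chosen so that the additive error `4 / 3 * (w * s)` is exactly `2 * c * w * ℓ / ε`.
  set s := 3 / 2 * c * ℓ / ε with hs
  have hms : 1 ≤ m * s := by
    have h1 : 8 * ε₀ < m * c := (div_lt_iff₀ hc).1 hm.2
    have h2 : m * s = 3 / 2 * (m * c) * ℓ / ε := by rw [hs]; ring
    rw [h2, le_div_iff₀ hε0]
    nlinarith
  clear_value s
  set T := ⌊m * s⌋₊ with hT
  set δ := 2 * Real.exp (-((c + D) * ℓ)) with hδ
  have hδ0 : 0 ≤ δ := by positivity
  have hδD : δ ≤ Real.exp (-(c * ℓ)) * (2 * Real.exp (-D)) := by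
    rw [hδ, mul_left_comm, ← Real.exp_add]
    gcongr
    nlinarith
  have hδm : δ ≤ Real.exp (-(c * ℓ)) * (1 / (4 * m)) := hδD.trans (by gcongr)
  have hexp : 0 < Real.exp ε - 1 := by linarith [Real.add_one_lt_exp hε0.ne']
  set E := (n : ℝ) ^ (c - 3) * (Real.exp ε - 1) / K with hE
  have hE0 : 0 ≤ E := by positivity
  have hkγ : (k : ℝ) ≤ β / 16 * r := hγ ▸ Nat.floor_le (by positivity)
  have hwQ : (w : ℝ) ≤ β / 16 * Q := by
    have h1 : (w : ℝ) / γ ≤ Q := Nat.le_ceil _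
    rwa [div_le_iff₀ hγ0, mul_comm, hγ] at h1
  have hrup : (r : ℝ) ≤ 2 * (c + D) * ℓ / γ ^ 2 + 1 := (Nat.ceil_lt_add_one (by positivity)).le
  have hQup : (Q : ℝ) ≤ w / γ + 1 := (Nat.ceil_lt_add_one (by positivity)).le
  have hT1 : 1 ≤ T := (Nat.le_floor_iff (by positivity)).2 (by exact_mod_cast hms)
  have hTs : (T : ℝ) ≤ m * s := Nat.floor_le (by positivity)
  have hmc : 2 * ε / m ≤ c / 4 := by
    have h1 : 8 * ε₀ < m * c := (div_lt_iff₀ hc).1 hm.2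
    rw [div_le_iff₀ (by positivity)]
    linarith
  have hTlow : m * (3 / 2 * c * ℓ / ε) ≤ (T : ℝ) + 1 := hs ▸ (Nat.lt_floor_add_one (m * s)).le
  have hτ := geom_tail_le hmpos hε0 hℓ1 hc hmc hTlow
  have hδr : 2 * Real.exp (-((β / 16) ^ 2 * r / 2)) ≤ δ := by
    have h1 : 2 * (c + D) * ℓ ≤ r * γ ^ 2 := (div_le_iff₀ (by positivity)).1 hrle
    rw [hδ, ← hγ]
    gcongr
    linarith
  clear_value r Q k T E δ
  have hmix := mix_condition hK1 hε0 hm1 (by exact_mod_cast hn3.trans' (by norm_num)) hnexp hδ0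
    hδm (by rw [hE, hrpow]) (rfl : 1 / (E + 1) = 1 / (E + 1))
  have hsα : β * s ≤ α / 8 := by
    have h1 : β * s = α * (3 / 2 * c / A) := by rw [hβ, hs]; field_simp
    have h2 : 3 / 2 * c / A ≤ 1 / 8 := by
      rw [div_le_iff₀ hA0]
      linarith
    rw [h1]
    nlinarith
  have hp1 : 1 / (E + 1) ≤ 1 := by
    rw [div_le_one (by positivity)]
    linarith
  obtain ⟨𝒜, hpriv, hacc, hquery⟩ := exists_private_estimator hw hwn hr0 hQ0 hk0 hkγ hwQ hβ0
    (by linarith) hmpos hε0 (by positivity) hp1 hδr hmix hT1 hTs hτ hα1 hβα hsα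
  refine ⟨𝒜, hpriv, ?_, ?_⟩
  · intro G L hG
    have hM : (0 : ℝ) ≤ G.mstWeight := Nat.cast_nonneg _
    refine le_trans ?_ (hacc G L hG _ (Set.Icc_subset_Icc ?_ ?_))
    · have h1 : 1 / (n : ℝ) ^ c = Real.exp (-(c * ℓ)) := by
        rw [hrpow, Real.exp_neg, one_div]
      rw [h1]
      have h2 := hδD.trans (mul_le_mul_of_nonneg_left hDκ (Real.exp_pos (-(c * ℓ))).le)
      linarith
    all_goals
      have h1 : 0 ≤ α * (ε / (1 * ℓ)) * (G.mstWeight : ℝ) := by positivity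
      have h2 : 4 / 3 * ((w : ℝ) * s) = 2 * c * w * ℓ / ε := by rw [hs]; ring
      have h3 : 0 ≤ 1 / ((K : ℝ) * (n : ℝ) ^ 3) := by positivity
      rw [h2]
      linarith
  · intro hN G L hG
    refine le_trans ?_ (hquery G L _ (query_bound (γ := γ) (ε₀ := ε₀) hA0 (by positivity) hα0 hα1
      hε0 hε (G.one_le_avgDegree (by omega) hG) hℓ1 ?_ hwr ?_ hγ1 (Nat.cast_nonneg _)
      hrup (Nat.cast_pos.2 hQ0) hQup))
    · rw [hrpow, one_div, ← Real.exp_neg]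
      gcongr
      linarith
    · rw [hℓ, Real.le_log_iff_exp_le hnr]
      exact (Nat.le_ceil _).trans (by exact_mod_cast hN)
    · rw [hγ, hβ]; field_simp
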